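/- **Conventions.** All functions are complex valued, $\widehat f(\xi)=\frac1{\sqrt{2\pi}}\int_{\mathbb R} f(x)e^{-i\xi x}\,dx$ (extended isometrically to $L_2(\mathbb R)$), and $\mathbb T=[-\pi,\pi)$. $PW_\pi$ is the space of (continuous versions of) $f\in L_2(\mathbb R)$ with $\widehat f=0$ a.e. outside $[-\pi,\pi]$. A real sequence $\mathcal X=(x_j)_{j\in\mathbb Z}$ is a *complete interpolating sequence* (CIS) for $PW_\pi$ if for every $(c_j)\in\ell_2(\mathbb Z)$ there is exactly one $f\in PW_\pi$ with $f(x_j)=c_j$ for all $j$. In that case every $h\in L_2(\mathbb T)$ has a unique expansion $h=\sum_j c_je^{-ix_j\cdot}$ in $L_2(\mathbb T)$ with $(c_j)\in\ell_2$, and for $k\in\mathbb Z$ the prolongation operator on $L_2(\mathbb T)$ is $A^k_{\mathcal X}h:=\sum_j c_je^{-ix_j(\cdot+2\pi k)}$. For $\psi\in L_2(\mathbb R)$ let $V(\psi,\mathcal X)$ be the closure in $L_2(\mathbb R)$ of $\operatorname{span}\{\psi(\cdot-x_j):j\in\mathbb Z\}$. Consider the conditions - (A1) $\psi\in L_2(\mathbb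 R)$ is positive definite, i.e. $\sum_{i,j}c_i\overline{c_j}\,\psi(t_i-t_j)\ge0$ for all finite families $t_i\in\mathbb R$, $c_i\in\mathbb C$; - (A2) $\sum_{j\in\mathbb Z}\|\widehat\psi(\cdot+2\pi j)\|_{L_\infty(\mathbb T)}<\infty$, $\delta_\psi:=\operatorname{ess\,inf}_{\mathbb T}|\widehat\psi|>0$, and $C_\psi:=\delta_\psi^{-1}\sum_{j\ne0}\|\widehat\psi(\cdot+2\pi j)\|_{L_\infty(\mathbb T)}<\infty$. For $\phi$ satisfying (A1) and (A2) define on $L_2(\mathbb T)$ the operators $M_\phi g=\dfrac{\delta_\phi}{\widehat\phi}\,g$ and $T_{\phi,k}g=\delta_\phi^{-1}\widehat\phi(\cdot+2\pi k)\,g$. **Statement.** Let $\mathcal X=(x_j)$ and $\mathcal Y=(y_j)$ be CISs for $PW_\pi$, let $\psi$ satisfy (A1) and (A2), and let $(\phi_\alpha)_{\alpha\in A}$ be a family of functions on $\mathbb R$; limits "$\alpha\to\infty$" are taken along a given filter on the index set $A$ (for instance, $A\subset\mathbb R$ unbounded above with the usual meaning of $\alpha\to\infty$). Suppose that - (B1)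 every $\phi_\alpha$ satisfies (A1) and (A2); - (B2) $\sup_{\alpha\in A}C_{\phi_\alpha}<\infty$; - (B3) $\lim_{\alpha\to\infty}\sum_{k\ne0}\|T_{\psi,k}A^k_{\mathcal X}(M_\psi-M_{\phi_\alpha})g\|_{L_2(\mathbb T)}=0$ for every $g\in L_2(\mathbb T)$; - (B4) $\lim_{\alpha\to\infty}\sum_{k\ne0}\|(T_{\phi_\alpha,k}A^k_{\mathcal Y}-T_{\psi,k}A^k_{\mathcal X})M_{\phi_\alpha}g\|_{L_2(\mathbb T)}=0$ for every $g\in L_2(\mathbb T)$. Let $f\in V(\psi,\mathcal X)$. Then $f$ has a continuous version, again denoted $f$; for every $\alpha\in A$ there is exactly one element $I^{\mathcal Y}_{\phi_\alpha}f$ of $V(\phi_\alpha,\mathcal Y)$, taken in its continuous version, with $I^{\mathcal Y}_{\phi_\alpha}f(y_k)=f(y_k)$ for all $k\in\mathbb Z$; and $$\lim_{\alpha\to\infty}\bigl|f(x)-I^{\mathcal Y}_{\phi_\alpha}f(x)\bigr|=0\quad\text{uniformly in }x\in\mathbb R.$$ -/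

import Mathlib

open MeasureTheory Filter Topology
open scoped ENNReal FourierTransform

noncomputable section

namespace QSI

/-- `L₂(ℝ)`, complex valued. -/
abbrev L2R : Type := Lp (α := ℝ) ℂ 2

/-- The torus `𝕋`, identified with `[-π, π)`, as a measure on `ℝ`. -/
abbrev torus : Measure ℝ := volume.restrict (Set.Ico (-Real.pi) Real.pi)

/-- `L₂(𝕋)`. -/
abbrev L2T : Type := Lp ℂ 2 torus

/-- The Fourier transform on `L₂(ℝ)` with the normalisation
`f̂(ξ) = (2π)^(-1/2) ∫ f(x) exp(-i ξ x) dx`, extended isometrically to `L₂(ℝ)`.  Mathlib's `𝓕` has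
the kernel `exp(-2π i ξ x)`, hence the rescaling.  (Set to `0` if `f ∉ L₂`; for `f ∈ L₂` the
function is determined up to a null set.) -/
def ft (f : ℝ → ℂ) : ℝ → ℂ :=
  open Classical in
  if h : MemLp f 2 (volume : Measure ℝ) then
    fun ξ => ((Real.sqrt (2 * Real.pi) : ℝ) : ℂ)⁻¹ *
      ((𝓕 (h.toLp f : L2R) : L2R) : ℝ → ℂ) (ξ / (2 * Real.pi))
  else 0

/-- The Paley–Wiener space `PW_σ`, each element being represented by its continuous version. -/
def paleyWiener (σ : ℝ) : Set (ℝ → ℂ) :=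
  {f | Continuous f ∧ MemLp f 2 (volume : Measure ℝ) ∧
    ∀ᵐ ξ : ℝ, ξ ∉ Set.Icc (-σ) σ → ft f ξ = 0}

/-- `x = (x_j)` is a complete interpolating sequence for `PW_π`: for each `c ∈ ℓ₂` there is exactly
one `f ∈ PW_π` with `f (x_j) = c_j` for all `j`. -/
def IsCIS (x : ℤ → ℝ) : Prop :=
  ∀ c : ℤ → ℂ, Memℓp c 2 → ∃! f : ℝ → ℂ, f ∈ paleyWiener Real.pi ∧ ∀ j, f (x j) = c j

/-- Positive definite function on `ℝ` (in the non-strict sense). -/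
def IsPosDefFun (ψ : ℝ → ℂ) : Prop :=
  ∀ (n : ℕ) (t : Fin n → ℝ) (c : Fin n → ℂ),
    0 ≤ (∑ i, ∑ j, c i * (starRingEnd ℂ) (c j) * ψ (t i - t j)).re ∧
    (∑ i, ∑ j, c i * (starRingEnd ℂ) (c j) * ψ (t i - t j)).im = 0

/-- `‖ψ̂(· + 2πk)‖` in `L_∞(𝕋)`. -/
def blockNorm (ψ : ℝ → ℂ) (k : ℤ) : ℝ≥0∞ :=
  eLpNorm (fun ξ => ft ψ (ξ + 2 * Real.pi * k)) ∞ torus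

/-- `δ_ψ`, the (essential) infimum of `|ψ̂|` over `𝕋`. -/
def delta (ψ : ℝ → ℂ) : ℝ≥0∞ := essInf (fun ξ => ‖ft ψ ξ‖ₑ) torus

/-- `C_ψ = (∑_{k ≠ 0} ‖ψ̂(· + 2πk)‖_{L_∞(𝕋)}) / δ_ψ`. -/
def genConst (ψ : ℝ → ℂ) : ℝ≥0∞ := (∑' k : {k : ℤ // k ≠ 0}, blockNorm ψ k) / delta ψ

/-- Condition (A1): `ψ ∈ L₂(ℝ)` is positive definite. -/
def CondA1 (ψ : ℝ → ℂ) : Prop := MemLp ψ 2 (volume : Measure ℝ) ∧ IsPosDefFun ψ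

/-- Condition (A2): `ψ̂ ∈ W(L_∞, ℓ₁)`, `δ_ψ > 0` and `C_ψ < ∞`. -/
def CondA2 (ψ : ℝ → ℂ) : Prop :=
  (∑' k : ℤ, blockNorm ψ k) < ∞ ∧ 0 < delta ψ ∧ genConst ψ < ∞

/-- The quasi shift-invariant space `V(ψ, x)`: the closure in `L₂(ℝ)` of the linear span of the
translates `ψ(· - x_j)`, `j ∈ ℤ`. -/
def space (ψ : ℝ → ℂ) (x : ℤ → ℝ) : Submodule ℂ L2R :=
  (Submodule.span ℂ
    {f : L2R | ∃ j : ℤ, (f : ℝ → ℂ) =ᵐ[volume] fun t => ψ (t - x j)}).topologicalClosure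

/-- `F` is the continuous version of the `L₂` class `f`. -/
def IsContVersion (f : L2R) (F : ℝ → ℂ) : Prop :=
  Continuous F ∧ (f : ℝ → ℂ) =ᵐ[volume] F

/-- `G` is (the continuous version of) an element of `V(φ, y)` that interpolates `F` at the points
`y_k`, `k ∈ ℤ`. -/
def IsInterpolant (φ : ℝ → ℂ) (y : ℤ → ℝ) (F G : ℝ → ℂ) : Prop :=
  (∃ g ∈ space φ y, IsContVersion g G) ∧ ∀ k : ℤ, G (y k) = F (y k)

lemma memLp_expo (s : ℝ) :
    MemLp (fun t : ℝ => Complex.exp (-Complex.I * s * t)) 2 torus := by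
  refine MemLp.of_bound (C := 1) ?_ ?_
  · exact (by fun_prop : Continuous fun t : ℝ =>
      Complex.exp (-Complex.I * s * t)).aestronglyMeasurable
  · refine Eventually.of_forall fun t => ?_
    rw [Complex.norm_exp]
    simp

/-- The exponential `t ↦ exp(-i s t)` as an element of `L₂(𝕋)`. -/
def expo (s : ℝ) : L2T := (memLp_expo s).toLp _

/-- The coefficients `c ∈ ℓ₂` of `h = ∑ c_j exp(-i x_j ·)` in `L₂(𝕋)`.  They exist and are unique
whenever `x` is a complete interpolating sequence. -/
def coeffs (x : ℤ → ℝ) (h : L2T) : ℤ → ℂ :=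
  open Classical in
  if H : ∃ c : ℤ → ℂ, Memℓp c 2 ∧ HasSum (fun j => c j • expo (x j)) h then H.choose else 0

/-- The prolongation operator `A_x^k`, which sends `h = ∑ c_j exp(-i x_j ·)` to
`∑ c_j exp(-i x_j (· + 2πk))`, as an element of `L₂(𝕋)`. -/
def prolong (x : ℤ → ℝ) (k : ℤ) (h : L2T) : L2T :=
  ∑' j : ℤ, (coeffs x h j * Complex.exp (-Complex.I * x j * (2 * Real.pi * k))) • expo (x j)

/-- Multiplication of `g ∈ L₂(𝕋)` by the function `m` (`0` if the product is not in `L₂(𝕋)`, which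
does not happen for `m` in `L_∞(𝕋)`). -/
def mulBy (m : ℝ → ℂ) (g : L2T) : L2T :=
  open Classical in
  if h : MemLp (fun ξ => m ξ * g ξ) 2 torus then h.toLp _ else 0

/-- `M_φ g = (δ_φ / φ̂) g`. -/
def opM (φ : ℝ → ℂ) (g : L2T) : L2T :=
  mulBy (fun ξ => ((delta φ).toReal : ℂ) / ft φ ξ) g

/-- `T_{φ,k} g = δ_φ⁻¹ φ̂(· + 2πk) g`. -/
def opT (φ : ℝ → ℂ) (k : ℤ) (g : L2T) : L2T :=
  mulBy (fun ξ => ((delta φ).toReal : ℂ)⁻¹ * ft φ (ξ + 2 * Real.pi * k)) g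

/-- Condition (B3): `∑_{k≠0} ‖T_{ψ,k} A_x^k (M_ψ - M_{φ_α}) g‖ → 0` for every `g ∈ L₂(𝕋)`. -/
def CondB3 {A : Type*} (l : Filter A) (ψ : ℝ → ℂ) (x : ℤ → ℝ) (φ : A → ℝ → ℂ) : Prop :=
  ∀ g : L2T, Tendsto
    (fun α => ∑' k : {k : ℤ // k ≠ 0}, ‖opT ψ k (prolong x k (opM ψ g - opM (φ α) g))‖ₑ)
    l (𝓝 0)

/-- Condition (B4): `∑_{k≠0} ‖(T_{φ_α,k} A_y^k - T_{ψ,k} A_x^k) M_{φ_α} g‖ → 0` for every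
`g ∈ L₂(𝕋)`. -/
def CondB4 {A : Type*} (l : Filter A) (ψ : ℝ → ℂ) (x y : ℤ → ℝ) (φ : A → ℝ → ℂ) : Prop :=
  ∀ g : L2T, Tendsto
    (fun α => ∑' k : {k : ℤ // k ≠ 0},
      ‖opT (φ α) k (prolong y k (opM (φ α) g)) - opT ψ k (prolong x k (opM (φ α) g))‖ₑ)
    l (𝓝 0)

end QSI

end

/-!
# Interpolation from quasi shift-invariant spaces

Cut the Fourier transform of `f ∈ L₂(ℝ)` into its blocks `B_k f = f̂(· + 2πk) ∈ L₂(𝕋)`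
(`block`).  A function with absolutely summable blocks has a continuous version, which is bounded
by `∑ ‖B_k f‖` (`isContVersion_ofBlocks`, `enorm_ofBlocks_le`), so everything takes place in
`L₂(𝕋)`.

A complete interpolating sequence `x` makes the exponentials `exp(-i x_j ·)` a Riesz basis of
`L₂(𝕋)` (`IsCIS.exists_synthesis`): the closed graph theorem bounds the solution operator of the
moment problem, hence `x` is separated, hence the moments of any `u ∈ L₂(𝕋)` are square summable.
The prolongation operators `A_x^k` are therefore uniformly bounded, and `f` belongs to `V(φ, x)`
exactly when `B_k f = T_{φ,k} A_x^k v` for all `k` and some `v ∈ L₂(𝕋)`, namely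
`v = M_φ (B_0 f)` (`block_eq_of_mem_space`, `gen_mem_space`).

The values `f(y_j)` are the moments, with respect to `exp(-i y_j ·)`, of `∑ (A_y^k)^* (B_k f)`
(`IsCIS.ofBlocks_apply`).  Interpolation from `V(φ, y)` thus amounts to solving `K v = d` with
`K = ∑ (A_y^k)^* T_{φ,k} A_y^k`.  A positive definite `φ` has `φ̂ ≥ 0` (`ft_nonneg`), so every
summand of `K` is positive, and the summand with `k = 0` is at least the identity.  Hence `K` is
invertible and `‖K⁻¹‖ ≤ 1` (`coercive_interpOp`), whatever the size of `φ̂` on `𝕋`.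

For convergence, let `g` be the interpolant of `f` and `r_k = B_k f - T_{φ,k} A_y^k M_φ B_0 f`.
Then `r_0 = 0`, and `∑_{k ≠ 0} ‖r_k‖` is at most the sum of the two quantities that tend to zero
by hypothesis.  With `v = M_φ B_0 (g - f)`, the blocks of `g - f` are `T_{φ,k} A_y^k v - r_k`, and
interpolation says `K v = ∑ (A_y^k)^* r_k`.  This bounds `v`, then the blocks with `k ≠ 0` through
`C_φ`, and finally the zeroth block, which the interpolation condition expresses through the others
(`tsum_enorm_sub_le`).
-/

noncomputable section

namespace QSI

/-! ### The Fourier transform on `L₁ ∩ L₂` -/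

open SchwartzMap in
/-- Locally integrable functions are determined by their integrals against Schwartz functions. -/
lemma ae_eq_of_forall_schwartz {f g : ℝ → ℂ} (hf : LocallyIntegrable f volume)
    (hg : LocallyIntegrable g volume)
    (h : ∀ s : 𝓢(ℝ, ℂ), ∫ t, s t * f t = ∫ t, s t * g t) : f =ᵐ[volume] g := by
  refine ae_eq_of_integral_contDiff_smul_eq hf hg fun s hs hc => ?_
  have h₁ : HasCompactSupport (Complex.ofRealCLM ∘ s) := hc.comp_left rfl
  have h₂ : ContDiff ℝ (⊤ : ℕ∞) (Complex.ofRealCLM ∘ s) :=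
    Complex.ofRealCLM.contDiff.comp hs
  simpa using h (h₁.toSchwartzMap h₂)

open SchwartzMap in
/-- The inverse Fourier transform may be moved from an integrable function to a Schwartz
function. -/
lemma integral_schwartz_mul_fourierInv {v : ℝ → ℂ} (hv : Integrable v) (s : 𝓢(ℝ, ℂ)) :
    ∫ t, s t * 𝓕⁻ v t = ∫ t, 𝓕⁻ s t * v t := by
  have h := VectorFourier.integral_fourierIntegral_smul_eq_flip (L := -innerₗ ℝ) (f := v) (g := s)
    Real.continuous_fourierChar
    (by simp only [LinearMap.neg_apply, innerₗ_apply_apply]; fun_prop) hv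
    (s.integrable (μ := volume))
  have e1 : VectorFourier.fourierIntegral Real.fourierChar volume (-innerₗ ℝ).flip s
      = 𝓕⁻ (s : ℝ → ℂ) := by
    ext t
    simp [VectorFourier.fourierIntegral, Real.fourierInv_eq, mul_comm]
  have e2 : VectorFourier.fourierIntegral Real.fourierChar volume (-innerₗ ℝ) v = 𝓕⁻ v := by
    ext t
    simp [VectorFourier.fourierIntegral, Real.fourierInv_eq]
  rw [e1, e2] at h
  simpa [mul_comm, SchwartzMap.fourierInv_coe] using h

lemma continuous_fourierInv {v : ℝ → ℂ} (hv : Integrable v) : Continuous (𝓕⁻ v) := by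
  have h := VectorFourier.fourierIntegral_continuous (L := -innerₗ ℝ)
    Real.continuous_fourierChar
    (by simp only [LinearMap.neg_apply, innerₗ_apply_apply]; fun_prop) hv
  convert h using 1
  ext t
  simp [VectorFourier.fourierIntegral, Real.fourierInv_eq]

/-- On `L₁ ∩ L₂` the inverse Fourier transform of `L₂(ℝ)` is given by the Fourier integral. -/
lemma fourierInv_toLp_ae {v : ℝ → ℂ} (h1 : Integrable v) (h2 : MemLp v 2 (volume : Measure ℝ)) :
    ((𝓕⁻ (h2.toLp v : L2R) : L2R) : ℝ → ℂ) =ᵐ[volume] 𝓕⁻ v := by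
  refine ae_eq_of_forall_schwartz ((Lp.memLp _).locallyIntegrable (by norm_num))
    (continuous_fourierInv h1).locallyIntegrable fun s => ?_
  rw [integral_schwartz_mul_fourierInv h1]
  have h := DFunLike.congr_fun (Lp.fourierInv_toTemperedDistribution_eq (h2.toLp v : L2R)) s
  rw [TemperedDistribution.fourierInv_apply] at h
  simp only [Lp.toTemperedDistribution_apply, smul_eq_mul] at h
  rw [← h]
  refine integral_congr_ae ?_
  filter_upwards [h2.coeFn_toLp] with t ht
  rw [ht]

open SchwartzMap in
/-- The inverse Fourier transform is injective on `L₁`. -/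
lemma ae_eq_zero_of_fourierInv_eq_zero {v : ℝ → ℂ} (hv : Integrable v) (h : ∀ x, 𝓕⁻ v x = 0) :
    v =ᵐ[volume] 0 := by
  refine ae_eq_of_forall_schwartz hv.locallyIntegrable
    (continuous_zero (X := ℝ) (M := ℂ)).locallyIntegrable fun s => ?_
  have h' := integral_schwartz_mul_fourierInv hv (𝓕 s)
  rw [FourierTransform.fourierInv_fourier_eq] at h'
  rw [← h']
  simp [h]

/-! ### Tiling the line by translates of the torus -/

lemma two_pi_pos : (0 : ℝ) < 2 * Real.pi := by positivity

instance : IsFiniteMeasure torus := ⟨by simp [torus]⟩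

/-- Lebesgue measure on a tile `[-π, π) + 2πk` is the translate of the measure on the torus. -/
lemma restrict_tile (k : ℤ) :
    volume.restrict
      (Set.Ico (-Real.pi + k • (2 * Real.pi)) (-Real.pi + (k + 1) • (2 * Real.pi)))
      = torus.map (fun ξ => ξ + 2 * Real.pi * k) := by
  have h := (measurePreserving_add_right (volume : Measure ℝ)
    (2 * Real.pi * k)).restrict_preimage_emb
      (MeasurableEquiv.addRight _).measurableEmbedding
      (Set.Ico (-Real.pi + k • (2 * Real.pi)) (-Real.pi + (k + 1) • (2 * Real.pi)))
  rw [← h.map_eq]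
  congr 2
  rw [Set.preimage_add_const_Ico]
  congr 1 <;> simp <;> ring

lemma measurableEmbedding_tile (k : ℤ) :
    MeasurableEmbedding (fun ξ : ℝ => ξ + 2 * Real.pi * k) :=
  (MeasurableEquiv.addRight (2 * Real.pi * k : ℝ)).measurableEmbedding

/-- An integral over the line is the sum of the integrals over the translates of the torus. -/
lemma lintegral_eq_tsum_tile (g : ℝ → ℝ≥0∞) :
    ∫⁻ ξ, g ξ = ∑' k : ℤ, ∫⁻ ξ, g (ξ + 2 * Real.pi * k) ∂torus := by
  simp_rw [← (measurableEmbedding_tile _).lintegral_map, ← restrict_tile]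
  rw [← lintegral_iUnion (fun k => measurableSet_Ico) (Set.pairwise_disjoint_Ico_add_zsmul _ _),
    iUnion_Ico_add_zsmul two_pi_pos, setLIntegral_univ]

/-- A property holds almost everywhere on the line if it does so on all translates of the torus. -/
lemma ae_of_forall_tile {p : ℝ → Prop} (hp : ∀ k : ℤ, ∀ᵐ ξ ∂torus, p (ξ + 2 * Real.pi * k)) :
    ∀ᵐ ξ, p ξ := by
  rw [← Measure.restrict_univ (μ := (volume : Measure ℝ)),
    ← iUnion_Ico_add_zsmul two_pi_pos (-Real.pi), ae_restrict_iUnion_iff]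
  intro k
  rw [restrict_tile, (measurableEmbedding_tile k).ae_map_iff]
  exact hp k

/-- A property that holds almost everywhere on the line does so on every translate. -/
lemma ae_tile_of_ae {p : ℝ → Prop} (hp : ∀ᵐ ξ, p ξ) (k : ℤ) :
    ∀ᵐ ξ ∂torus, p (ξ + 2 * Real.pi * k) :=
  ae_restrict_of_ae ((measurePreserving_add_right (volume : Measure ℝ)
    (2 * Real.pi * k)).quasiMeasurePreserving.ae hp)

/-! ### Weighted composition operators between `L₂` spaces -/

/-- The map `g ↦ c · (g ∘ a)` is bounded from `L₂(μ)` to `L₂(ν)` with constant `C`. -/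
def IsWeightedComp (μ ν : Measure ℝ) (c : ℝ → ℂ) (a : ℝ → ℝ) (C : ℝ) : Prop :=
  ∀ g : ℝ → ℂ, MemLp g 2 μ → MemLp (fun ξ => c ξ * g (a ξ)) 2 ν ∧
    eLpNorm (fun ξ => c ξ * g (a ξ)) 2 ν ≤ ENNReal.ofReal C * eLpNorm g 2 μ

namespace IsWeightedComp

variable {μ ν : Measure ℝ} {c : ℝ → ℂ} {a : ℝ → ℝ} {C : ℝ}

lemma congr_ae (H : IsWeightedComp μ ν c a C) {g g' : ℝ → ℂ} (hg : MemLp g 2 μ)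
    (hg' : MemLp g' 2 μ) (h : g =ᵐ[μ] g') :
    (fun ξ => c ξ * g (a ξ)) =ᵐ[ν] fun ξ => c ξ * g' (a ξ) := by
  have h1 := H (g - g') (hg.sub hg')
  have h0 : eLpNorm (g - g') 2 μ = 0 := by
    rw [eLpNorm_congr_ae (g := 0)]
    · simp
    · filter_upwards [h] with x hx
      simp [hx]
  have h2 := h1.2
  rw [h0, mul_zero, nonpos_iff_eq_zero, eLpNorm_eq_zero_iff h1.1.1 (by norm_num)] at h2
  filter_upwards [h2] with x hx
  simpa [mul_sub, sub_eq_zero] using hx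

/-- The bounded operator `g ↦ c · (g ∘ a)` from `L₂(μ)` to `L₂(ν)`. -/
def toCLM (H : IsWeightedComp μ ν c a C) : Lp ℂ 2 μ →L[ℂ] Lp ℂ 2 ν :=
  LinearMap.mkContinuous
    { toFun := fun g => (H g (Lp.memLp g)).1.toLp _
      map_add' := fun f g => by
        rw [← MemLp.toLp_add]
        refine MemLp.toLp_congr _ _ ?_
        refine (H.congr_ae (Lp.memLp _) ((Lp.memLp f).add (Lp.memLp g))
          (Lp.coeFn_add f g)).trans (Eventually.of_forall fun ξ => ?_)
        simp [mul_add]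
      map_smul' := fun r g => by
        rw [RingHom.id_apply, ← MemLp.toLp_const_smul]
        refine MemLp.toLp_congr _ _ ?_
        refine (H.congr_ae (Lp.memLp _) ((Lp.memLp g).const_smul r)
          (Lp.coeFn_smul r g)).trans (Eventually.of_forall fun ξ => ?_)
        simp [mul_left_comm] } (max C 0) fun g => by
    have h := (H g (Lp.memLp g)).2
    change ‖(H g (Lp.memLp g)).1.toLp _‖ ≤ _
    rw [Lp.norm_toLp, Lp.norm_def, ← ENNReal.toReal_ofReal (le_max_right C 0),
      ← ENNReal.toReal_mul]
    refine ENNReal.toReal_mono (ENNReal.mul_ne_top ENNReal.ofReal_ne_top (Lp.eLpNorm_ne_top g)) ?_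
    simpa [ENNReal.ofReal_max] using h

lemma coeFn_toCLM (H : IsWeightedComp μ ν c a C) (g : Lp ℂ 2 μ) :
    (H.toCLM g : ℝ → ℂ) =ᵐ[ν] fun ξ => c ξ * g (a ξ) :=
  (H g (Lp.memLp g)).1.coeFn_toLp

lemma norm_toCLM_le (H : IsWeightedComp μ ν c a C) (hC : 0 ≤ C) : ‖H.toCLM‖ ≤ C :=
  (LinearMap.mkContinuous_norm_le _ (le_max_right C 0) _).trans_eq (max_eq_left hC)

end IsWeightedComp

lemma isWeightedComp_mul {m : ℝ → ℂ} {C : ℝ} (hm : AEStronglyMeasurable m torus)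
    (hC : eLpNorm m ∞ torus ≤ ENNReal.ofReal C) : IsWeightedComp torus torus m id C := by
  intro g hg
  have hm' : MemLp m ∞ torus := ⟨hm, hC.trans_lt ENNReal.ofReal_lt_top⟩
  refine ⟨hg.mul hm', ?_⟩
  refine (eLpNorm_smul_le_mul_eLpNorm (r := 2) (p := ∞) (q := 2) hg.1 hm).trans ?_
  gcongr

/-- Composition with the affine map `ξ ↦ pξ + q` scales the `L₂`-norm. -/
lemma memLp_comp_affine {p : ℝ} (hp : p ≠ 0) (q : ℝ) {g : ℝ → ℂ}
    (hg : MemLp g 2 (volume : Measure ℝ)) :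
    MemLp (fun ξ => g (p * ξ + q)) 2 (volume : Measure ℝ) ∧
      eLpNorm (fun ξ => g (p * ξ + q)) 2 volume
        = ENNReal.ofReal |p⁻¹| ^ (1 / 2 : ℝ) * eLpNorm g 2 volume := by
  have hq : MemLp (fun ξ => g (ξ + q)) 2 (volume : Measure ℝ) :=
    hg.comp_measurePreserving (measurePreserving_add_right volume q)
  have hqn : eLpNorm (fun ξ => g (ξ + q)) 2 volume = eLpNorm g 2 volume :=
    eLpNorm_comp_measurePreserving hg.1 (measurePreserving_add_right volume q)
  have hmap := Real.map_volume_mul_left hp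
  have hq' : MemLp (fun ξ => g (ξ + q)) 2 (Measure.map (p * ·) (volume : Measure ℝ)) := by
    rw [hmap]
    exact hq.smul_measure ENNReal.ofReal_ne_top
  refine ⟨hq'.comp_of_map (by fun_prop), ?_⟩
  have := eLpNorm_map_measure (p := 2) (μ := (volume : Measure ℝ)) (f := (p * ·)) hq'.1
    (by fun_prop)
  rw [hmap, eLpNorm_smul_measure_of_ne_top (by norm_num), hqn] at this
  simpa [Function.comp_def] using this.symm

/-- Null sets pull back to null sets under affine maps. -/
lemma quasiMeasurePreserving_affine {p : ℝ} (hp : p ≠ 0) (q : ℝ) :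
    Measure.QuasiMeasurePreserving (fun ξ : ℝ => p * ξ + q) := by
  refine (measurePreserving_add_right (volume : Measure ℝ) q).quasiMeasurePreserving.comp
    ⟨by fun_prop, ?_⟩
  rw [Real.map_volume_mul_left hp]
  exact Measure.smul_absolutelyContinuous

/-! ### Blocks of the Fourier transform -/

/-- `√(2π)` as a complex number. -/
abbrev sqrtTwoPi : ℂ := ((Real.sqrt (2 * Real.pi) : ℝ) : ℂ)

lemma sqrtTwoPi_ne_zero : sqrtTwoPi ≠ 0 := by
  exact Complex.ofReal_ne_zero.2 (Real.sqrt_pos.2 two_pi_pos).ne'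

lemma isWeightedComp_block (k : ℤ) :
    IsWeightedComp volume torus (fun _ => sqrtTwoPi⁻¹)
      (fun ξ => (ξ + 2 * Real.pi * k) / (2 * Real.pi)) 1 := by
  intro g hg
  have h := memLp_comp_affine (p := (2 * Real.pi)⁻¹) (inv_ne_zero two_pi_pos.ne') k hg
  have e : (fun ξ => g ((ξ + 2 * Real.pi * k) / (2 * Real.pi)))
      = fun ξ => g ((2 * Real.pi)⁻¹ * ξ + k) := by
    funext ξ
    congr 1
    field_simp
  have e' : (fun ξ => sqrtTwoPi⁻¹ * g ((ξ + 2 * Real.pi * k) / (2 * Real.pi)))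
      = sqrtTwoPi⁻¹ • fun ξ => g ((2 * Real.pi)⁻¹ * ξ + k) := by
    rw [← e]; rfl
  rw [e']
  refine ⟨(h.1.restrict _).const_smul _, ?_⟩
  rw [eLpNorm_const_smul]
  refine (mul_le_mul_right (eLpNorm_mono_measure _ Measure.restrict_le_self) _).trans ?_
  rw [h.2, ← mul_assoc]
  gcongr
  rw [inv_inv, abs_of_pos two_pi_pos, ENNReal.ofReal_rpow_of_nonneg two_pi_pos.le (by norm_num),
    ← Real.sqrt_eq_rpow, ← ofReal_norm, ← ENNReal.ofReal_mul (norm_nonneg _)]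
  have h0 := Real.sqrt_pos.2 two_pi_pos
  rw [norm_inv, Complex.norm_real, Real.norm_of_nonneg h0.le, inv_mul_cancel₀ h0.ne']

/-- The `k`-th block `f̂(· + 2πk)` of the Fourier transform of `f`, restricted to the torus. -/
def block (k : ℤ) : L2R →L[ℂ] L2T :=
  (isWeightedComp_block k).toCLM ∘L
    ((Lp.fourierTransformₗᵢ ℝ ℂ).toContinuousLinearEquiv : L2R →L[ℂ] L2R)

lemma ft_toLp {f : ℝ → ℂ} (hf : MemLp f 2 (volume : Measure ℝ)) :
    ft f = fun ξ => sqrtTwoPi⁻¹ *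
      ((𝓕 (hf.toLp f : L2R) : L2R) : ℝ → ℂ) (ξ / (2 * Real.pi)) := by
  rw [ft, dif_pos hf]

lemma coeFn_block_toLp {f : ℝ → ℂ} (hf : MemLp f 2 (volume : Measure ℝ)) (k : ℤ) :
    (block k (hf.toLp f) : ℝ → ℂ) =ᵐ[torus] fun ξ => ft f (ξ + 2 * Real.pi * k) := by
  rw [ft_toLp hf]
  exact (isWeightedComp_block k).coeFn_toCLM _

lemma aestronglyMeasurable_ft {f : ℝ → ℂ} (hf : MemLp f 2 (volume : Measure ℝ)) :
    AEStronglyMeasurable (ft f) (volume : Measure ℝ) := by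
  rw [ft_toLp hf]
  have h := memLp_comp_affine (p := (2 * Real.pi)⁻¹) (inv_ne_zero two_pi_pos.ne') 0
    (Lp.memLp (𝓕 (hf.toLp f : L2R) : L2R))
  simp only [add_zero] at h
  simp_rw [div_eq_inv_mul]
  exact h.1.1.const_mul _

/-- An element of `L₂(ℝ)` all of whose blocks vanish is zero. -/
lemma eq_zero_of_block_eq_zero {f : L2R} (h : ∀ k, block k f = 0) : f = 0 := by
  have h0 : ∀ᵐ ξ : ℝ, (𝓕 f : L2R) (ξ / (2 * Real.pi)) = 0 := by
    refine ae_of_forall_tile fun k => ?_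
    have h1 := (isWeightedComp_block k).coeFn_toCLM (𝓕 f : L2R)
    have h2 := Lp.coeFn_zero ℂ 2 torus
    rw [← h k] at h2
    filter_upwards [h1, h2] with ξ h1 h2
    exact (mul_eq_zero.1 (h1.symm.trans h2)).resolve_left (inv_ne_zero sqrtTwoPi_ne_zero)
  have h1 := (quasiMeasurePreserving_affine two_pi_pos.ne' 0).ae h0
  have h2 : (𝓕 f : L2R) = 0 := by
    rw [Lp.eq_zero_iff_ae_eq_zero]
    filter_upwards [h1] with ξ hξ
    simpa [mul_div_cancel_left₀ _ two_pi_pos.ne'] using hξ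
  exact (Lp.fourierTransformₗᵢ ℝ ℂ).map_eq_zero_iff.1 h2

lemma block_ext {f g : L2R} (h : ∀ k, block k f = block k g) : f = g :=
  sub_eq_zero.1 (eq_zero_of_block_eq_zero fun k => by rw [map_sub, h, sub_self])

/-! ### Exponentials on the torus -/

lemma coeFn_expo (s : ℝ) :
    (expo s : ℝ → ℂ) =ᵐ[torus] fun t => Complex.exp (-Complex.I * s * t) :=
  (memLp_expo s).coeFn_toLp

lemma torus_univ : torus Set.univ = ENNReal.ofReal (2 * Real.pi) := by
  simp [torus, two_mul]

lemma norm_le_of_ae_bound_torus {f : L2T} {C : ℝ} (hC : 0 ≤ C) (h : ∀ᵐ t ∂torus, ‖f t‖ ≤ C) :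
    ‖f‖ ≤ Real.sqrt (2 * Real.pi) * C := by
  have := Lp.norm_le_of_ae_bound hC h
  have e : (measureUnivNNReal torus : ℝ) = 2 * Real.pi := by
    rw [measureUnivNNReal, torus_univ, ENNReal.coe_toNNReal_eq_toReal,
      ENNReal.toReal_ofReal two_pi_pos.le]
  rw [e] at this
  rw [Real.sqrt_eq_rpow]
  simpa using this

lemma norm_expo_le (s : ℝ) : ‖expo s‖ ≤ Real.sqrt (2 * Real.pi) := by
  have := norm_le_of_ae_bound_torus (f := expo s) zero_le_one (by
    filter_upwards [coeFn_expo s] with t ht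
    rw [ht, Complex.norm_exp]
    simp)
  simpa using this

lemma ae_abs_le_pi : ∀ᵐ t ∂torus, |t| ≤ Real.pi := by
  filter_upwards [ae_restrict_mem measurableSet_Ico] with t ht
  exact abs_le.2 ⟨ht.1, ht.2.le⟩

lemma norm_expo_sub_le (s t : ℝ) :
    ‖expo s - expo t‖ ≤ Real.sqrt (2 * Real.pi) * (Real.pi * |s - t|) := by
  refine norm_le_of_ae_bound_torus (by positivity) ?_
  filter_upwards [coeFn_expo s, coeFn_expo t, Lp.coeFn_sub (expo s) (expo t), ae_abs_le_pi]
    with ξ h1 h2 h3 h4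
  rw [h3, Pi.sub_apply, h1, h2]
  have e1 : Complex.exp (-Complex.I * s * ξ) - Complex.exp (-Complex.I * t * ξ)
      = Complex.exp (-Complex.I * t * ξ)
        * (Complex.exp (Complex.I * ((t - s) * ξ : ℝ)) - 1) := by
    rw [mul_sub, ← Complex.exp_add, mul_one]
    congr 2
    push_cast
    ring
  rw [e1, norm_mul, Complex.norm_exp]
  have := Real.norm_exp_I_mul_ofReal_sub_one_le (x := (t - s) * ξ)
  rw [norm_mul, Real.norm_eq_abs, Real.norm_eq_abs, abs_sub_comm] at this
  calc _ ≤ 1 * (|s - t| * |ξ|) := by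
        gcongr
        · simp
    _ ≤ _ := by
        rw [one_mul, mul_comm]
        gcongr

lemma continuous_expo : Continuous expo := by
  refine LipschitzWith.continuous (K := Real.toNNReal (Real.sqrt (2 * Real.pi) * Real.pi))
    (LipschitzWith.of_dist_le_mul fun s t => ?_)
  rw [dist_eq_norm, Real.dist_eq, Real.coe_toNNReal _ (by positivity), mul_assoc]
  exact norm_expo_sub_le s t

lemma inner_expo (s : ℝ) (u : L2T) :
    inner ℂ (expo s) u = ∫ t, Complex.exp (Complex.I * s * t) * u t ∂torus := by
  rw [L2.inner_def]
  refine integral_congr_ae ?_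
  filter_upwards [coeFn_expo s] with t ht
  rw [ht, RCLike.inner_apply, mul_comm, ← Complex.exp_conj]
  simp

/-! ### Functions with one Fourier block -/

lemma isWeightedComp_unblock (k : ℤ) :
    IsWeightedComp torus volume
      (fun η => (Set.Ico (-Real.pi) Real.pi).indicator (fun _ => sqrtTwoPi)
        (2 * Real.pi * η + -(2 * Real.pi * k)))
      (fun η => 2 * Real.pi * η + -(2 * Real.pi * k)) 1 := by
  intro g hg
  have e : (fun η => (Set.Ico (-Real.pi) Real.pi).indicator (fun _ => sqrtTwoPi)
        (2 * Real.pi * η + -(2 * Real.pi * k)) * g (2 * Real.pi * η + -(2 * Real.pi * k)))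
      = sqrtTwoPi • fun η => (Set.Ico (-Real.pi) Real.pi).indicator g
        (2 * Real.pi * η + -(2 * Real.pi * k)) := by
    funext η
    by_cases h : 2 * Real.pi * η + -(2 * Real.pi * k) ∈ Set.Ico (-Real.pi) Real.pi
    · simp only [Pi.smul_apply, Set.indicator_of_mem h, smul_eq_mul]
    · simp only [Pi.smul_apply, Set.indicator_of_notMem h, smul_eq_mul, zero_mul, mul_zero]
  rw [e]
  have hg' : MemLp ((Set.Ico (-Real.pi) Real.pi).indicator g) 2 (volume : Measure ℝ) :=
    (memLp_indicator_iff_restrict measurableSet_Ico).2 hg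
  have h := memLp_comp_affine two_pi_pos.ne' (-(2 * Real.pi * k)) hg'
  refine ⟨h.1.const_smul _, ?_⟩
  rw [eLpNorm_const_smul, h.2, eLpNorm_indicator_eq_eLpNorm_restrict measurableSet_Ico, ← mul_assoc]
  gcongr
  have h0 := Real.sqrt_pos.2 two_pi_pos
  rw [abs_of_pos (inv_pos.2 two_pi_pos),
    ENNReal.ofReal_rpow_of_nonneg (inv_pos.2 two_pi_pos).le (by norm_num),
    ← Real.sqrt_eq_rpow, ← ofReal_norm, ← ENNReal.ofReal_mul (norm_nonneg _),
    Complex.norm_real, Real.norm_of_nonneg h0.le, Real.sqrt_inv, mul_inv_cancel₀ h0.ne']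

/-- The element of `L₂(ℝ)` whose `k`-th block is `u` and whose other blocks vanish. -/
def unblock (k : ℤ) : L2T →L[ℂ] L2R :=
  ((Lp.fourierTransformₗᵢ ℝ ℂ).symm.toContinuousLinearEquiv : L2R →L[ℂ] L2R) ∘L
    (isWeightedComp_unblock k).toCLM

lemma norm_unblock_le (k : ℤ) (u : L2T) : ‖unblock k u‖ ≤ ‖u‖ := by
  change ‖(Lp.fourierTransformₗᵢ ℝ ℂ).symm ((isWeightedComp_unblock k).toCLM u)‖ ≤ _
  rw [LinearIsometryEquiv.norm_map]
  simpa using ((isWeightedComp_unblock k).toCLM).le_of_opNorm_le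
    ((isWeightedComp_unblock k).norm_toCLM_le zero_le_one) u

lemma block_unblock (m k : ℤ) (u : L2T) : block m (unblock k u) = if m = k then u else 0 := by
  have e : block m (unblock k u)
      = (isWeightedComp_block m).toCLM ((isWeightedComp_unblock k).toCLM u) := by
    change (isWeightedComp_block m).toCLM ((Lp.fourierTransformₗᵢ ℝ ℂ)
      ((Lp.fourierTransformₗᵢ ℝ ℂ).symm _)) = _
    rw [LinearIsometryEquiv.apply_symm_apply]
    rfl
  rw [e]
  have h1 := (isWeightedComp_block m).coeFn_toCLM ((isWeightedComp_unblock k).toCLM u)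
  have h2 := ae_restrict_of_ae (s := Set.Ico (-Real.pi) Real.pi)
    ((quasiMeasurePreserving_affine (inv_ne_zero two_pi_pos.ne') m).ae
    ((isWeightedComp_unblock k).coeFn_toCLM u))
  have h3 : ∀ᵐ t ∂torus, t ∈ Set.Ico (-Real.pi) Real.pi := ae_restrict_mem measurableSet_Ico
  have hpi := two_pi_pos.ne'
  have e1 : ∀ ξ : ℝ, (ξ + 2 * Real.pi * m) / (2 * Real.pi) = (2 * Real.pi)⁻¹ * ξ + m := by
    intro ξ
    field_simp
  have e2 : ∀ ξ : ℝ, 2 * Real.pi * ((2 * Real.pi)⁻¹ * ξ + m) + -(2 * Real.pi * k)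
      = ξ + (m - k : ℤ) * (2 * Real.pi) := by
    intro ξ
    push_cast
    field_simp
    ring
  split_ifs with hmk
  · subst hmk
    refine Lp.ext ?_
    filter_upwards [h1, h2, h3] with ξ h1 h2 h3
    rw [h1, e1, h2, e2]
    simp only [sub_self, Int.cast_zero, zero_mul, add_zero]
    rw [Set.indicator_of_mem h3, ← mul_assoc, inv_mul_cancel₀ sqrtTwoPi_ne_zero, one_mul]
  · rw [Lp.eq_zero_iff_ae_eq_zero]
    filter_upwards [h1, h2, h3] with ξ h1 h2 h3
    rw [h1, e1, h2, e2, Set.indicator_of_notMem, zero_mul, mul_zero, Pi.zero_apply]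
    intro h4
    have hp := two_pi_pos
    have h5 : ((m - k : ℤ) : ℝ) * (2 * Real.pi) < 1 * (2 * Real.pi) := by linarith [h4.2, h3.1]
    have h6 : (-1 : ℝ) * (2 * Real.pi) < ((m - k : ℤ) : ℝ) * (2 * Real.pi) := by
      linarith [h4.1, h3.2]
    have h7 := lt_of_mul_lt_mul_right h5 hp.le
    have h8 := lt_of_mul_lt_mul_right h6 hp.le
    have h9 : m - k < 1 := by exact_mod_cast h7
    have h10 : -1 < m - k := by exact_mod_cast h8
    omega

/-- Fourier inversion for a function with a single block. -/
lemma coeFn_unblock (k : ℤ) (u : L2T) :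
    (unblock k u : ℝ → ℂ) =ᵐ[volume] fun x =>
      sqrtTwoPi⁻¹ * (Complex.exp (Complex.I * x * (2 * Real.pi * k)) * inner ℂ (expo x) u) := by
  set G : ℝ → ℂ := (Set.Ico (-Real.pi) Real.pi).indicator (fun _ => sqrtTwoPi) with hG
  have h2 : MemLp (fun η => G (2 * Real.pi * η + -(2 * Real.pi * k)) *
      u (2 * Real.pi * η + -(2 * Real.pi * k))) 2 (volume : Measure ℝ) :=
    (isWeightedComp_unblock k u (Lp.memLp u)).1
  have h1' : Integrable (fun ξ => G ξ * u ξ) (volume : Measure ℝ) := by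
    have : (fun ξ => G ξ * u ξ)
        = (Set.Ico (-Real.pi) Real.pi).indicator (fun ξ => sqrtTwoPi * u ξ) := by
      funext ξ
      simp only [hG, Set.indicator_apply]
      split_ifs <;> simp
    rw [this, integrable_indicator_iff measurableSet_Ico]
    exact (((Lp.memLp u).integrable (by norm_num)).const_mul _)
  have h1 : Integrable (fun η => G (2 * Real.pi * η + -(2 * Real.pi * k)) *
      u (2 * Real.pi * η + -(2 * Real.pi * k))) (volume : Measure ℝ) :=
    (h1'.comp_add_right (-(2 * Real.pi * k))).comp_mul_left' two_pi_pos.ne'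
  refine (fourierInv_toLp_ae h1 h2).trans (Eventually.of_forall fun x => ?_)
  rw [Real.fourierInv_eq']
  set K : ℝ → ℂ := fun ξ => Complex.exp (Complex.I * x * (2 * Real.pi * k)) *
    (Complex.exp (Complex.I * x * ξ) * (G ξ * u ξ)) with hK
  have e : ∀ η : ℝ, Complex.exp (↑(2 * Real.pi * inner ℝ η x) * Complex.I) •
      (G (2 * Real.pi * η + -(2 * Real.pi * k)) * u (2 * Real.pi * η + -(2 * Real.pi * k)))
      = K (2 * Real.pi * η + -(2 * Real.pi * k)) := by
    intro η
    simp only [smul_eq_mul, hK]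
    rw [← mul_assoc (Complex.exp _) (Complex.exp _) (G _ * _), ← Complex.exp_add]
    congr 2
    simp
    ring
  simp_rw [e]
  rw [Measure.integral_comp_mul_left (fun y => K (y + -(2 * Real.pi * k))) (2 * Real.pi),
    integral_add_right_eq_self K, hK, integral_const_mul, inner_expo]
  have e3 : (fun ξ : ℝ => Complex.exp (Complex.I * x * ξ) * (G ξ * u ξ))
      = (Set.Ico (-Real.pi) Real.pi).indicator
        fun ξ => sqrtTwoPi * (Complex.exp (Complex.I * x * ξ) * u ξ) := by
    funext ξ
    simp only [hG, Set.indicator_apply]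
    split_ifs
    · ring
    · simp
  rw [e3, integral_indicator measurableSet_Ico, integral_const_mul,
    abs_of_pos (inv_pos.2 two_pi_pos), Complex.real_smul]
  have e4 : ((((2 * Real.pi)⁻¹ : ℝ)) : ℂ) * sqrtTwoPi = sqrtTwoPi⁻¹ := by
    have := Real.mul_self_sqrt two_pi_pos.le
    refine eq_inv_of_mul_eq_one_left ?_
    rw [mul_assoc, ← Complex.ofReal_mul, this,
      ← Complex.ofReal_mul, inv_mul_cancel₀ two_pi_pos.ne', Complex.ofReal_one]
  rw [← e4]
  ring

/-! ### Continuous versions -/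

/-- The pointwise sum of the inverse Fourier transforms of the blocks `w k`. -/
def ofBlocks (w : ℤ → L2T) (x : ℝ) : ℂ :=
  sqrtTwoPi⁻¹ * ∑' k : ℤ, Complex.exp (Complex.I * x * (2 * Real.pi * k)) * inner ℂ (expo x) (w k)

lemma norm_exp_I_mul_real (x y : ℝ) : ‖Complex.exp (Complex.I * x * y)‖ = 1 := by
  rw [Complex.norm_exp]
  simp

lemma norm_ofBlocks_term_le (x : ℝ) (k : ℤ) (u : L2T) :
    ‖Complex.exp (Complex.I * x * (2 * Real.pi * k)) * inner ℂ (expo x) u‖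
      ≤ Real.sqrt (2 * Real.pi) * ‖u‖ := by
  have h := norm_exp_I_mul_real x (2 * Real.pi * k)
  push_cast at h
  rw [norm_mul, h, one_mul]
  refine (norm_inner_le_norm _ _).trans ?_
  gcongr
  exact norm_expo_le x

lemma summable_ofBlocks {w : ℤ → L2T} (hw : Summable fun k => ‖w k‖) (x : ℝ) :
    Summable fun k : ℤ =>
      Complex.exp (Complex.I * x * (2 * Real.pi * k)) * inner ℂ (expo x) (w k) :=
  Summable.of_norm_bounded (hw.mul_left _) fun k => norm_ofBlocks_term_le x k (w k)

lemma continuous_ofBlocks {w : ℤ → L2T} (hw : Summable fun k => ‖w k‖) :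
    Continuous (ofBlocks w) := by
  refine continuous_const.mul (continuous_tsum (fun k => ?_)
    (hw.mul_left (Real.sqrt (2 * Real.pi))) fun k x => norm_ofBlocks_term_le x k (w k))
  exact (by fun_prop : Continuous fun x : ℝ =>
    Complex.exp (Complex.I * x * (2 * Real.pi * k))).mul (continuous_expo.inner continuous_const)

lemma enorm_ofBlocks_le (w : ℤ → L2T) (x : ℝ) : ‖ofBlocks w x‖ₑ ≤ ∑' k, ‖w k‖ₑ := by
  by_cases hw : ∑' k, ‖w k‖ₑ = ∞
  · rw [hw]
    exact le_top
  have h0 := Real.sqrt_pos.2 two_pi_pos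
  have hw' : Summable fun k => ‖w k‖ := by
    have := ENNReal.summable_toReal hw
    simpa using this
  have h1 : ‖ofBlocks w x‖ ≤ ∑' k, ‖w k‖ := by
    rw [ofBlocks, norm_mul, norm_inv, Complex.norm_real, Real.norm_of_nonneg h0.le,
      inv_mul_le_iff₀ h0, ← tsum_mul_left]
    exact tsum_of_norm_bounded (hw'.mul_left _).hasSum fun k => norm_ofBlocks_term_le x k (w k)
  have h2 := ENNReal.ofReal_le_ofReal h1
  rw [ENNReal.ofReal_tsum_of_nonneg (fun _ => norm_nonneg _) hw'] at h2
  simpa using h2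

lemma ofBlocks_sub {w w' : ℤ → L2T} (hw : Summable fun k => ‖w k‖)
    (hw' : Summable fun k => ‖w' k‖) (x : ℝ) :
    ofBlocks (fun k => w k - w' k) x = ofBlocks w x - ofBlocks w' x := by
  simp only [ofBlocks, inner_sub_right, mul_sub]
  rw [(summable_ofBlocks hw x).tsum_sub (summable_ofBlocks hw' x), mul_sub]

/-- A sum that converges both in `L₂` and pointwise has the same limit in both senses. -/
lemma ae_eq_of_hasSum {ι : Type*} [Countable ι] {f : ι → L2R} {g : L2R} {F : ι → ℝ → ℂ}
    {G : ℝ → ℂ} (hf : HasSum f g) (hF : ∀ x, HasSum (fun i => F i x) (G x))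
    (hfF : ∀ i, (f i : ℝ → ℂ) =ᵐ[volume] F i) : (g : ℝ → ℂ) =ᵐ[volume] G := by
  have h1 : TendstoInMeasure volume (fun s : Finset ι => ((∑ i ∈ s, f i : L2R) : ℝ → ℂ)) atTop g :=
    tendstoInMeasure_of_tendsto_Lp hf
  obtain ⟨ns, hns, h2⟩ := h1.exists_seq_tendsto_ae'
  have h3 : ∀ᵐ x, ∀ i, f i x = F i x := ae_all_iff.2 hfF
  have h4 : ∀ᵐ x : ℝ, ∀ s : Finset ι, (∑ i ∈ s, f i : L2R) x = ∑ i ∈ s, f i x := by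
    refine ae_all_iff.2 fun s => ?_
    filter_upwards [Lp.coeFn_finsetSum s f] with x hx
    simpa using hx
  filter_upwards [h2, h3, h4] with x h2 h3 h4
  refine tendsto_nhds_unique h2 ?_
  simp_rw [h4, h3]
  exact (hF x).comp hns

/-- The element of `L₂(ℝ)` with prescribed, absolutely summable blocks. -/
def glue (w : ℤ → L2T) : L2R := ∑' k, unblock k (w k)

lemma hasSum_glue {w : ℤ → L2T} (hw : Summable fun k => ‖w k‖) :
    HasSum (fun k => unblock k (w k)) (glue w) :=
  (Summable.of_norm_bounded hw fun k => norm_unblock_le k (w k)).hasSum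

lemma block_glue {w : ℤ → L2T} (hw : Summable fun k => ‖w k‖) (m : ℤ) :
    block m (glue w) = w m := by
  have h := (block m).hasSum (hasSum_glue hw)
  simp only [block_unblock] at h
  exact h.unique (by
    convert hasSum_ite_eq m (w m) using 2 with k
    by_cases hk : m = k
    · simp [hk]
    · simp [hk, Ne.symm hk])

/-- Fourier inversion for functions with absolutely summable blocks. -/
lemma isContVersion_ofBlocks {f : L2R} (hf : Summable fun k => ‖block k f‖) :
    IsContVersion f (ofBlocks fun k => block k f) := by
  refine ⟨continuous_ofBlocks hf, ?_⟩
  have e : f = glue fun k => block k f := block_ext fun k => (block_glue hf k).symm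
  conv_lhs => rw [e]
  exact ae_eq_of_hasSum (hasSum_glue hf)
    (fun x => (summable_ofBlocks hf x).hasSum.mul_left _) fun k => coeFn_unblock k _

lemma IsContVersion.unique {f : L2R} {F G : ℝ → ℂ} (hF : IsContVersion f F)
    (hG : IsContVersion f G) : F = G :=
  Continuous.ae_eq_iff_eq volume hF.1 hG.1 |>.1 (hF.2.symm.trans hG.2)

/-! ### Positive definite functions have a nonnegative Fourier transform -/

section PosDef

open scoped ComplexOrder

lemma IsPosDefFun.nonneg {φ : ℝ → ℂ} (h : IsPosDefFun φ) {ι : Type*} [Fintype ι]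
    (t : ι → ℝ) (c : ι → ℂ) :
    0 ≤ ∑ i, ∑ j, c i * (starRingEnd ℂ) (c j) * φ (t i - t j) := by
  have h1 := h (Fintype.card ι) (t ∘ (Fintype.equivFin ι).symm) (c ∘ (Fintype.equivFin ι).symm)
  simp only [Function.comp_apply] at h1
  have h2 : ∀ i, ∑ j, c i * (starRingEnd ℂ) (c ((Fintype.equivFin ι).symm j)) *
      φ (t i - t ((Fintype.equivFin ι).symm j))
      = ∑ j, c i * (starRingEnd ℂ) (c j) * φ (t i - t j) := fun i =>
    (Fintype.equivFin ι).symm.sum_comp fun j => c i * (starRingEnd ℂ) (c j) * φ (t i - t j)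
  simp_rw [h2, (Fintype.equivFin ι).symm.sum_comp fun i =>
    ∑ j, c i * (starRingEnd ℂ) (c j) * φ (t i - t j)] at h1
  exact Complex.nonneg_iff.2 ⟨h1.1, h1.2.symm⟩

/-- Tuples of points whose pairwise differences avoid a given null set are dense. -/
lemma dense_forall_sub {P : ℝ → Prop} (hP : ∀ᵐ t, P t) (ι : Type*) [Fintype ι] :
    Dense {s : ι → ℝ | ∀ i j, i ≠ j → P (s i - s j)} := by
  refine Measure.dense_of_ae (μ := (volume : Measure (ι → ℝ))) ?_
  refine ae_all_iff.2 fun i => ae_all_iff.2 fun j => ?_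
  by_cases hij : i = j
  · exact Eventually.of_forall fun _ h => absurd hij h
  let L : (ι → ℝ) →ₗ[ℝ] ℝ := 
    LinearMap.proj (R := ℝ) (φ := fun _ : ι => ℝ) i - LinearMap.proj j
  have hL : Function.Surjective L := fun r => by
    classical
    refine ⟨Pi.single i r, ?_⟩
    simp [L, Ne.symm hij]
  obtain ⟨S, hS, hSm, hS0⟩ := exists_measurable_superset_of_null (ae_iff.1 hP)
  have h1 : ∀ᵐ t : ℝ, t ∈ Sᶜ := by
    rw [ae_iff]
    simpa using hS0
  filter_upwards [(ae_comp_linearMap_mem_iff L volume volume hL hSm.compl).2 h1] with s hs _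
  by_contra hn
  exact hs (hS hn)

/-- A positive definite function need not be continuous, but a continuous function that agrees with
it almost everywhere is again positive definite.  Only the diagonal terms of the quadratic form can
see the difference, and they become negligible when every point is repeated many times. -/
lemma IsPosDefFun.congr_ae {φ Φ : ℝ → ℂ} (h : IsPosDefFun φ) (hΦ : Continuous Φ)
    (he : φ =ᵐ[volume] Φ) : IsPosDefFun Φ := by
  have key : ∀ {ι : Type} [Fintype ι] [DecidableEq ι] (t : ι → ℝ) (c : ι → ℂ),
      0 ≤ ∑ i, ∑ j, c i * (starRingEnd ℂ) (c j) * (if i = j then φ 0 else Φ (t i - t j)) := by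
    intro ι _ _ t c
    -- both sides are continuous in the points, and for generic points `φ` and `Φ` agree
    have hd := dense_forall_sub he ι
    have hcl : IsClosed {t : ι → ℝ |
        0 ≤ ∑ i, ∑ j, c i * (starRingEnd ℂ) (c j) * (if i = j then φ 0 else Φ (t i - t j))} := by
      refine isClosed_le continuous_const ?_
      refine continuous_finsetSum _ fun i _ => continuous_finsetSum _ fun j _ => ?_
      split_ifs
      · exact continuous_const
      · exact continuous_const.mul (hΦ.comp (by fun_prop))
    refine hcl.closure_subset_iff.2 ?_ (hd t)
    intro s hs
    have h1 := h.nonneg s c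
    rw [Set.mem_ofPred_eq]
    convert h1 using 6 with i _ j _
    split_ifs with hij
    · simp [hij]
    · exact (hs i j hij).symm
  intro n t c
  set Q : ℂ := ∑ i, ∑ j, c i * (starRingEnd ℂ) (c j) * Φ (t i - t j) with hQ
  set D : ℂ := ∑ i, c i * (starRingEnd ℂ) (c i) * (φ 0 - Φ 0) with hD
  -- repeat every point `N` times
  have hN : ∀ N : ℕ, 0 ≤ (N : ℂ) * (N * Q + D) := by
    intro N
    have h1 := key (ι := Fin n × Fin N) (fun p => t p.1) (fun p => c p.1)
    have h2 : ∀ p q : Fin n × Fin N, c p.1 * (starRingEnd ℂ) (c q.1) *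
        (if p = q then φ 0 else Φ (t p.1 - t q.1))
        = c p.1 * (starRingEnd ℂ) (c q.1) * Φ (t p.1 - t q.1)
          + if p = q then c p.1 * (starRingEnd ℂ) (c q.1) * (φ 0 - Φ 0) else 0 := by
      intro p q
      split_ifs with hpq
      · subst hpq
        rw [sub_self]
        ring
      · rw [add_zero]
    beta_reduce at h1
    simp_rw [h2, Finset.sum_add_distrib] at h1
    simp only [Finset.sum_ite_eq, Finset.mem_univ, if_true] at h1
    simp only [Fintype.sum_prod_type, Finset.sum_const, Finset.card_univ, Fintype.card_fin,
      nsmul_eq_mul, ← Finset.mul_sum] at h1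
    convert h1 using 1
    rw [← hQ, ← hD]
    ring
  have hre : ∀ N : ℕ, 0 < N → 0 ≤ N * Q.re + D.re := by
    intro N hN0
    have h1 := (Complex.nonneg_iff.1 (hN N)).1
    simp only [Complex.mul_re, Complex.add_re, Complex.natCast_re, Complex.natCast_im, zero_mul,
      sub_zero] at h1
    exact nonneg_of_mul_nonneg_right h1 (by exact_mod_cast hN0)
  have him : ∀ N : ℕ, 0 < N → N * Q.im + D.im = 0 := by
    intro N hN0
    have h1 := (Complex.nonneg_iff.1 (hN N)).2
    simp only [Complex.mul_im, Complex.add_im, Complex.natCast_re, Complex.natCast_im, zero_mul,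
      add_zero] at h1
    exact (mul_eq_zero.1 h1.symm).resolve_left (by exact_mod_cast hN0.ne')
  constructor
  · by_contra! hneg
    obtain ⟨N, hN⟩ := exists_nat_gt (D.re / -Q.re)
    rw [div_lt_iff₀ (by linarith)] at hN
    have h1 := hre (N + 1) N.succ_pos
    push_cast at h1
    nlinarith
  · have h1 := him 1 one_pos
    have h2 := him 2 two_pos
    push_cast at h1 h2
    linarith

/-- An integrable function is nonnegative if its inverse Fourier transform is positive definite.

Positive definiteness says `∫ |v|² p ≥ 0` for all trigonometric sums `v`.  By injectivity of the
Fourier transform on `L₁`, the functions `v √|p|` are dense in the `L₂` functions vanishing where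
`p` does, so that `v` may be replaced by the indicator function of any measurable set. -/
lemma ae_nonneg_of_isPosDefFun {p : ℝ → ℂ} (hp : Integrable p) (h : IsPosDefFun (𝓕⁻ p)) :
    ∀ᵐ ξ, 0 ≤ p ξ := by
  classical
  set r : ℝ → ℂ := fun ξ => ((Real.sqrt ‖p ξ‖ : ℝ) : ℂ) with hr
  have hrr : ∀ ξ, r ξ * r ξ = (‖p ξ‖ : ℂ) := fun ξ => by
    rw [hr, ← Complex.ofReal_mul, Real.mul_self_sqrt (norm_nonneg _)]
  have hrm : AEStronglyMeasurable r volume :=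
    Complex.continuous_ofReal.comp_aestronglyMeasurable
      (Real.continuous_sqrt.comp_aestronglyMeasurable hp.1.norm)
  have hr2 : MemLp r 2 (volume : Measure ℝ) := by
    rw [memLp_two_iff_integrable_sq_norm hrm]
    refine hp.norm.congr (Eventually.of_forall fun ξ => ?_)
    simp [hr, abs_of_nonneg, Real.sqrt_nonneg]
  -- the sign of `p` acts as a bounded multiplier
  have hs : IsWeightedComp volume volume (fun ξ => p ξ / (‖p ξ‖ : ℂ)) id 1 := by
    intro g hg
    have hb : ∀ ξ, ‖p ξ / (‖p ξ‖ : ℂ) * g ξ‖ ≤ ‖g ξ‖ := fun ξ => by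
      rw [norm_mul, norm_div, Complex.norm_real, norm_norm]
      exact mul_le_of_le_one_left (norm_nonneg _) (div_self_le_one _)
    have hm : AEStronglyMeasurable (fun ξ => p ξ / (‖p ξ‖ : ℂ) * g ξ) volume :=
      (hp.1.div₀ (Complex.continuous_ofReal.comp_aestronglyMeasurable hp.1.norm)).mul hg.1
    refine ⟨hg.mono hm (Eventually.of_forall hb), ?_⟩
    rw [ENNReal.ofReal_one, one_mul]
    exact eLpNorm_mono hb
  have hexp : ∀ (t : ℝ) (u : ℝ → ℂ), MemLp u 2 (volume : Measure ℝ) →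
      MemLp (fun ξ : ℝ => Complex.exp (2 * Real.pi * t * ξ * Complex.I) * u ξ) 2
        (volume : Measure ℝ) := by
    intro t u hu
    refine hu.of_le ((by fun_prop : Continuous fun ξ : ℝ =>
      Complex.exp (2 * Real.pi * t * ξ * Complex.I)).aestronglyMeasurable.mul hu.1)
      (Eventually.of_forall fun ξ => ?_)
    rw [norm_mul, Complex.norm_exp]
    simp
  set w : ℝ → L2R := fun t => (hexp t r hr2).toLp with hw
  have hwc : ∀ t, (w t : ℝ → ℂ) =ᵐ[volume] fun ξ =>
      Complex.exp (2 * Real.pi * t * ξ * Complex.I) * r ξ := fun t => (hexp t r hr2).coeFn_toLp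
  have hconj : ∀ s ξ : ℝ, (starRingEnd ℂ) (2 * Real.pi * s * ξ * Complex.I)
      = -(2 * Real.pi * s * ξ * Complex.I) := fun s ξ => by
    have e : (2 * Real.pi * s * ξ * Complex.I : ℂ)
        = ((2 * Real.pi * s * ξ : ℝ) : ℂ) * Complex.I := by push_cast; ring
    rw [e, map_mul, Complex.conj_ofReal, Complex.conj_I, mul_neg]
  have hform : ∀ s t, inner ℂ (w s) (hs.toCLM (w t)) = 𝓕⁻ p (t - s) := by
    intro s t
    rw [L2.inner_def, Real.fourierInv_eq']
    refine integral_congr_ae ?_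
    filter_upwards [hwc s, hwc t, hs.coeFn_toCLM (w t)] with ξ h1 h2 h3
    rw [h3, h1, id, h2, RCLike.inner_apply, map_mul, ← Complex.exp_conj, hr, Complex.conj_ofReal]
    have e : p ξ / (‖p ξ‖ : ℂ) * (r ξ * r ξ) = p ξ := by
      rw [hrr]
      by_cases h0 : p ξ = 0
      · simp [h0]
      · exact div_mul_cancel₀ _ (by simpa using h0)
    have e2 : Complex.exp (↑(2 * Real.pi * inner ℝ ξ (t - s)) * Complex.I)
        = Complex.exp (2 * Real.pi * t * ξ * Complex.I)
          * Complex.exp ((starRingEnd ℂ) (2 * Real.pi * s * ξ * Complex.I)) := by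
      rw [← Complex.exp_add, hconj]
      congr 1
      simp
      ring
    rw [e2, smul_eq_mul]
    conv_rhs => rw [← e]
    simp only [hr]
    ring
  have hpos : ∀ v ∈ (Submodule.span ℂ (Set.range w)).topologicalClosure,
      0 ≤ inner ℂ v (hs.toCLM v) := by
    have hcl : IsClosed {v : L2R | 0 ≤ inner ℂ v (hs.toCLM v)} :=
      isClosed_le continuous_const (continuous_id.inner hs.toCLM.continuous)
    refine fun v hv => hcl.closure_subset_iff.2 ?_ hv
    intro v hv
    obtain ⟨n, c, g, rfl⟩ := Submodule.mem_span_set'.1 hv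
    choose t ht using fun i => (g i).2
    rw [Set.mem_ofPred_eq]
    have h1 := h.nonneg t c
    rw [Finset.sum_comm] at h1
    convert h1 using 1
    simp_rw [map_sum, map_smul, sum_inner, inner_sum, inner_smul_left, inner_smul_right, ← ht,
      hform]
    refine Finset.sum_congr rfl fun i _ => Finset.sum_congr rfl fun j _ => ?_
    ring
  have hS : ∀ S : Set ℝ, MeasurableSet S → 0 ≤ ∫ ξ in S, p ξ := by
    intro S hS
    have hm := hr2.indicator hS
    -- an element orthogonal to all `w t` vanishes almost everywhere where `p` does not
    have hmem : hm.toLp ∈ (Submodule.span ℂ (Set.range w)).topologicalClosure := by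
      rw [← Submodule.orthogonal_orthogonal_eq_closure]
      rw [Submodule.mem_orthogonal]
      intro u hu
      have h1 : Integrable (fun ξ => r ξ * u ξ) := hr2.integrable_mul (Lp.memLp u)
      have h2 : (fun ξ => r ξ * u ξ) =ᵐ[volume] 0 := by
        refine ae_eq_zero_of_fourierInv_eq_zero h1 fun x => ?_
        rw [Real.fourierInv_eq']
        have h3 := (Submodule.mem_orthogonal _ _).1 hu (w (-x)) (Submodule.subset_span ⟨_, rfl⟩)
        rw [L2.inner_def] at h3
        rw [← h3]
        refine integral_congr_ae ?_
        filter_upwards [hwc (-x)] with ξ h4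
        rw [h4]
        simp only [RCLike.inner_apply, conj_trivial]
        have e : Complex.exp (↑(2 * Real.pi * (x * ξ)) * Complex.I)
            = Complex.exp (-(2 * Real.pi * (-x : ℝ) * ξ * Complex.I)) := by
          congr 1
          push_cast
          ring
        rw [map_mul, ← Complex.exp_conj, hconj, e, smul_eq_mul]
        simp only [hr, Complex.conj_ofReal]
        ring
      rw [L2.inner_def]
      refine integral_eq_zero_of_ae ?_
      filter_upwards [h2, hm.coeFn_toLp] with ξ h3 h4
      rw [h4, RCLike.inner_apply, Set.indicator_apply]
      split_ifs
      · rcases mul_eq_zero.1 h3 with h5 | h5 <;> simp [h5]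
      · simp
    have h1 := hpos _ hmem
    convert h1 using 1
    rw [L2.inner_def, ← integral_indicator hS]
    refine integral_congr_ae ?_
    filter_upwards [hm.coeFn_toLp, hs.coeFn_toCLM hm.toLp] with ξ h2 h3
    rw [h3, id, h2, RCLike.inner_apply, Set.indicator_apply, Set.indicator_apply]
    split_ifs
    · have e : p ξ / (‖p ξ‖ : ℂ) * (r ξ * r ξ) = p ξ := by
        rw [hrr]
        by_cases h0 : p ξ = 0
        · simp [h0]
        · exact div_mul_cancel₀ _ (by simpa using h0)
      conv_lhs => rw [← e]
      simp only [hr, Complex.conj_ofReal]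
      ring
    · simp
  have hSre : ∀ S : Set ℝ, MeasurableSet S →
      0 ≤ (∫ ξ in S, (p ξ).re) ∧ ∫ ξ in S, (p ξ).im = 0 := by
    intro S hS'
    have h1 := Complex.nonneg_iff.1 (hS S hS')
    have h2 : ∫ ξ in S, (p ξ).re = (∫ ξ in S, p ξ).re := integral_re hp.integrableOn
    have h3 : ∫ ξ in S, (p ξ).im = (∫ ξ in S, p ξ).im := integral_im hp.integrableOn
    rw [h2, h3]
    exact ⟨h1.1, h1.2.symm⟩
  have h1 : 0 ≤ᵐ[volume] fun ξ => (p ξ).re :=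
    ae_nonneg_of_forall_setIntegral_nonneg hp.re fun S hS' _ => (hSre S hS').1
  have h2 : (fun ξ => (p ξ).im) =ᵐ[volume] 0 :=
    hp.im.ae_eq_zero_of_forall_setIntegral_eq_zero fun S hS' _ => (hSre S hS').2
  filter_upwards [h1, h2] with ξ h1 h2
  exact Complex.nonneg_iff.2 ⟨h1, h2.symm⟩

lemma lintegral_tile_le (f : ℝ → ℂ) (k : ℤ) :
    ∫⁻ ξ, ‖ft f (ξ + 2 * Real.pi * k)‖ₑ ∂torus ≤ blockNorm f k * torus Set.univ := by
  refine lintegral_mono_ae (ae_le_eLpNormEssSup (μ := torus)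
    (f := fun ξ => ft f (ξ + 2 * Real.pi * k))) |>.trans ?_
  rw [lintegral_const, blockNorm, eLpNorm_exponent_top]

lemma integrable_ft {f : ℝ → ℂ} (hf : MemLp f 2 (volume : Measure ℝ))
    (hs : ∑' k : ℤ, blockNorm f k < ∞) : Integrable (ft f) := by
  refine ⟨aestronglyMeasurable_ft hf, ?_⟩
  rw [HasFiniteIntegral, lintegral_eq_tsum_tile]
  refine (ENNReal.tsum_le_tsum fun k => lintegral_tile_le f k).trans_lt ?_
  rw [ENNReal.tsum_mul_right]
  exact ENNReal.mul_lt_top hs (measure_lt_top _ _)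

/-- Bochner's theorem for integrable Fourier transforms: a positive definite function has a
nonnegative Fourier transform. -/
lemma ft_nonneg {φ : ℝ → ℂ} (h1 : CondA1 φ) (h2 : CondA2 φ) : ∀ᵐ ξ, 0 ≤ ft φ ξ := by
  set p : L2R := 𝓕 (h1.1.toLp φ : L2R) with hp
  have hft : ft φ = fun ξ => sqrtTwoPi⁻¹ * p (ξ / (2 * Real.pi)) := ft_toLp h1.1
  have hpi : Integrable p := by
    have h3 := ((integrable_ft h1.1 h2.1).comp_mul_left' two_pi_pos.ne').const_mul sqrtTwoPi
    refine h3.congr (Eventually.of_forall fun ξ => ?_)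
    simp only [hft]
    rw [mul_div_cancel_left₀ _ two_pi_pos.ne', mul_inv_cancel_left₀ sqrtTwoPi_ne_zero]
  have hinv : φ =ᵐ[volume] 𝓕⁻ (p : ℝ → ℂ) := by
    have h3 := fourierInv_toLp_ae hpi (Lp.memLp p)
    rw [Lp.toLp_coeFn] at h3
    have h4 : (𝓕⁻ p : L2R) = h1.1.toLp φ := (Lp.fourierTransformₗᵢ ℝ ℂ).symm_apply_apply _
    rw [h4] at h3
    exact h1.1.coeFn_toLp.symm.trans h3
  have h3 := ae_nonneg_of_isPosDefFun hpi (h1.2.congr_ae (continuous_fourierInv hpi) hinv)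
  have h4 := (quasiMeasurePreserving_affine (inv_ne_zero two_pi_pos.ne') 0).ae h3
  filter_upwards [h4] with ξ hξ
  rw [add_zero, ← div_eq_inv_mul] at hξ
  rw [hft, ← Complex.ofReal_inv]
  exact mul_nonneg (by rw [Complex.zero_le_real]; positivity) hξ

end PosDef

/-! ### Complete interpolating sequences as a moment problem -/

/-- The function of `PW_π` with Fourier transform `u` on the torus. -/
def pwFun (u : L2T) (t : ℝ) : ℂ := sqrtTwoPi⁻¹ * inner ℂ (expo t) u

lemma isContVersion_pwFun (u : L2T) : IsContVersion (unblock 0 u) (pwFun u) := by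
  refine ⟨continuous_const.mul (continuous_expo.inner continuous_const), ?_⟩
  refine (coeFn_unblock 0 u).trans (Eventually.of_forall fun x => ?_)
  simp [pwFun]

lemma memLp_pwFun (u : L2T) : MemLp (pwFun u) 2 (volume : Measure ℝ) :=
  (Lp.memLp (unblock 0 u)).ae_eq (isContVersion_pwFun u).2

lemma toLp_pwFun (u : L2T) : (memLp_pwFun u).toLp = unblock 0 u :=
  Lp.ext ((memLp_pwFun u).coeFn_toLp.trans (isContVersion_pwFun u).2.symm)

lemma pwFun_mem_paleyWiener (u : L2T) : pwFun u ∈ paleyWiener Real.pi := by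
  refine ⟨(isContVersion_pwFun u).1, memLp_pwFun u, ae_of_forall_tile fun k => ?_⟩
  by_cases hk : k = 0
  · subst hk
    filter_upwards [ae_restrict_mem measurableSet_Ico] with ξ hξ hn
    refine absurd ⟨?_, ?_⟩ hn
    · simpa using hξ.1
    · simpa using hξ.2.le
  · have h1 := coeFn_block_toLp (memLp_pwFun u) k
    rw [toLp_pwFun, block_unblock, if_neg hk] at h1
    filter_upwards [h1, Lp.coeFn_zero ℂ 2 torus] with ξ h1 h2 _
    rw [← h1, h2, Pi.zero_apply]

/-- The Paley–Wiener space is parametrised by `L₂(𝕋)`. -/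
lemma exists_pwFun_eq {f : ℝ → ℂ} (hf : f ∈ paleyWiener Real.pi) : ∃ u, pwFun u = f := by
  obtain ⟨hc, hm, hz⟩ := hf
  refine ⟨block 0 (hm.toLp f), ?_⟩
  have e : unblock 0 (block 0 (hm.toLp f)) = hm.toLp f := by
    refine block_ext fun k => ?_
    rw [block_unblock]
    split_ifs with hk
    · rw [hk]
    · symm
      rw [Lp.eq_zero_iff_ae_eq_zero]
      have h0 : ∀ᵐ ξ ∂torus, ξ ≠ -Real.pi := ae_restrict_of_ae (Measure.ae_ne volume _)
      filter_upwards [coeFn_block_toLp hm k, ae_tile_of_ae hz k, h0,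
        ae_restrict_mem measurableSet_Ico] with ξ h1 h2 h3 h4
      rw [h1, Pi.zero_apply]
      refine h2 fun h5 => ?_
      have hp := Real.pi_pos
      have h6 : -Real.pi < ξ := lt_of_le_of_ne h4.1 (Ne.symm h3)
      have h7 : (k : ℝ) * (2 * Real.pi) < 1 * (2 * Real.pi) := by linarith [h5.2]
      have h8 : (-1 : ℝ) * (2 * Real.pi) < k * (2 * Real.pi) := by linarith [h5.1, h4.2]
      have h9 := lt_of_mul_lt_mul_right h7 two_pi_pos.le
      have h10 := lt_of_mul_lt_mul_right h8 two_pi_pos.le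
      have h11 : k < 1 := by exact_mod_cast h9
      have h12 : -1 < k := by exact_mod_cast h10
      omega
  refine (isContVersion_pwFun _).unique ⟨hc, ?_⟩
  rw [e]
  exact hm.coeFn_toLp

/-- For a complete interpolating sequence the moment problem `⟨exp(-i x_j ·), u⟩ = c_j` in `L₂(𝕋)`
has exactly one solution for each `c ∈ ℓ₂`. -/
lemma IsCIS.existsUnique_moment {x : ℤ → ℝ} (hx : IsCIS x) {c : ℤ → ℂ} (hc : Memℓp c 2) :
    ∃! u : L2T, ∀ j, inner ℂ (expo (x j)) u = c j := by
  obtain ⟨f, ⟨hf, hfc⟩, hu⟩ := hx (fun j => sqrtTwoPi⁻¹ * c j) (hc.const_smul sqrtTwoPi⁻¹)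
  obtain ⟨u, rfl⟩ := exists_pwFun_eq hf
  refine ⟨u, fun j => mul_left_cancel₀ (inv_ne_zero sqrtTwoPi_ne_zero) (hfc j), fun v hv => ?_⟩
  have h1 : pwFun v = pwFun u :=
    hu _ ⟨pwFun_mem_paleyWiener v, fun j => by rw [pwFun, hv j]⟩
  have h2 : unblock 0 v = unblock 0 u := by
    rw [← toLp_pwFun, ← toLp_pwFun]
    exact MemLp.toLp_congr _ _ (by rw [h1])
  have h3 := congrArg (block 0) h2
  simpa [block_unblock] using h3

/-- `ℓ₂(ℤ)`. -/
abbrev Ell2 : Type := lp (fun _ : ℤ => ℂ) 2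

lemma IsCIS.eq_of_inner_expo {x : ℤ → ℝ} (hx : IsCIS x) {u v : L2T}
    (h : ∀ j, inner ℂ (expo (x j)) u = inner ℂ (expo (x j)) v) : u = v := by
  have h0 : Memℓp (fun _ : ℤ => (0 : ℂ)) 2 := zero_memℓp
  refine sub_eq_zero.1 ((hx.existsUnique_moment h0).unique (fun j => ?_) fun j => ?_)
  · rw [inner_sub_right, h, sub_self]
  · rw [inner_zero_right]

/-- The bounded operator that solves the moment problem of a complete interpolating sequence.
Boundedness follows from the closed graph theorem. -/
lemma IsCIS.exists_solution {x : ℤ → ℝ} (hx : IsCIS x) :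
    ∃ S : Ell2 →L[ℂ] L2T, ∀ c j, inner ℂ (expo (x j)) (S c) = c j := by
  choose S hS using fun c : Ell2 => (hx.existsUnique_moment c.2).exists
  let L : Ell2 →ₗ[ℂ] L2T :=
    { toFun := S
      map_add' := fun c d => hx.eq_of_inner_expo fun j => by
        rw [inner_add_right, hS, hS, hS]
        rfl
      map_smul' := fun r c => hx.eq_of_inner_expo fun j => by
        rw [inner_smul_right, hS, hS]
        rfl }
  refine ⟨⟨L, L.continuous_of_seq_closed_graph fun w c u hw hu => ?_⟩, hS⟩
  refine hx.eq_of_inner_expo fun j => ?_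
  have h1 : Tendsto (fun n => inner ℂ (expo (x j)) (L (w n))) atTop
      (𝓝 (inner ℂ (expo (x j)) u)) :=
    ((continuous_const.inner continuous_id).tendsto u).comp hu
  have h2 : Tendsto (fun n => w n j) atTop (𝓝 (c j)) := by
    have h3 : LipschitzWith 1 fun c : Ell2 => c j := by
      refine LipschitzWith.of_dist_le_mul fun c d => ?_
      rw [NNReal.coe_one, one_mul, dist_eq_norm, dist_eq_norm]
      exact lp.norm_apply_le_norm (by norm_num) (c - d) j
    exact (h3.continuous.tendsto c).comp hw
  have h4 : ∀ n, inner ℂ (expo (x j)) (L (w n)) = w n j := fun n => hS (w n) j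
  simp_rw [h4] at h1
  rw [tendsto_nhds_unique h1 h2]
  exact (hS c j).symm

/-- A complete interpolating sequence is separated. -/
lemma IsCIS.separated {x : ℤ → ℝ} (hx : IsCIS x) :
    ∃ δ > 0, ∀ i j, i ≠ j → δ ≤ |x i - x j| := by
  obtain ⟨S, hS⟩ := hx.exists_solution
  set K : ℝ := Real.sqrt (2 * Real.pi) * Real.pi * (‖S‖ + 1) with hK
  have hK0 : 0 < K := by
    have := Real.sqrt_pos.2 two_pi_pos
    have := Real.pi_pos
    positivity
  refine ⟨K⁻¹, inv_pos.2 hK0, fun i j hij => ?_⟩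
  -- the solution for the `i`-th unit vector distinguishes `expo (x i)` from `expo (x j)`
  set e : Ell2 := lp.single 2 i (1 : ℂ) with he
  have hi : inner ℂ (expo (x i)) (S e) = 1 := by
    rw [hS, he, lp.single_apply_self]
  have hj : inner ℂ (expo (x j)) (S e) = 0 := by
    rw [hS, he, lp.single_apply_ne _ _ _ (Ne.symm hij)]
  have h1 : inner ℂ (expo (x i) - expo (x j)) (S e) = 1 := by
    rw [inner_sub_left, hi, hj, sub_zero]
  have h2 : ‖S e‖ ≤ ‖S‖ + 1 := by
    have := S.le_opNorm e
    rw [he, lp.norm_single (by norm_num), norm_one, mul_one] at this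
    linarith
  have h3 : 1 ≤ K * |x i - x j| := by
    calc (1 : ℝ) = ‖inner ℂ (expo (x i) - expo (x j)) (S e)‖ := by rw [h1, norm_one]
      _ ≤ ‖expo (x i) - expo (x j)‖ * ‖S e‖ := norm_inner_le_norm _ _
      _ ≤ (Real.sqrt (2 * Real.pi) * (Real.pi * |x i - x j|)) * (‖S‖ + 1) := by
        gcongr
        exact norm_expo_sub_le _ _
      _ = _ := by rw [hK]; ring
  rwa [inv_le_iff_one_le_mul₀' hK0]

/-! ### The Bessel property of separated exponentials -/

/-- The Fourier multiplier `t ↦ ∫_{-h}^h exp(i s t) ds` of integration over `[-h, h)`. -/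
def boxMul (h : ℝ) (t : ℝ) : ℂ := ∫ s in Set.Ico (-h) h, Complex.exp (Complex.I * s * t)

lemma continuous_boxMul (h : ℝ) : Continuous (boxMul h) := by
  refine continuous_of_dominated (bound := fun _ => 1) (fun t => ?_) (fun t => ?_)
    (integrable_const _) (Eventually.of_forall fun s => by fun_prop)
  · exact (by fun_prop : Continuous fun s : ℝ =>
      Complex.exp (Complex.I * s * t)).aestronglyMeasurable
  · exact Eventually.of_forall fun s => (norm_exp_I_mul_real s t).le

lemma le_norm_boxMul {h t : ℝ} (h0 : 0 < h) (h1 : h ≤ 1 / 4) (ht : |t| ≤ Real.pi) :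
    h ≤ ‖boxMul h t‖ := by
  have hint : Integrable (fun s : ℝ => Complex.exp (Complex.I * s * t))
      (volume.restrict (Set.Ico (-h) h)) := by
    refine Integrable.of_bound (C := 1) (by fun_prop : Continuous fun s : ℝ =>
      Complex.exp (Complex.I * s * t)).aestronglyMeasurable ?_
    exact Eventually.of_forall fun s => (norm_exp_I_mul_real s t).le
  have hre : (boxMul h t).re = ∫ s in Set.Ico (-h) h, (Complex.exp (Complex.I * s * t)).re :=
    (integral_re hint).symm
  refine le_trans ?_ (Complex.re_le_norm _)
  rw [hre]
  have h2 : ∫ s in Set.Ico (-h) h, (1 / 2 : ℝ) = h := by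
    rw [setIntegral_const, Measure.real, Real.volume_Ico, ENNReal.toReal_ofReal (by linarith),
      smul_eq_mul]
    ring
  refine h2.ge.trans ?_
  refine setIntegral_mono_on (integrable_const _) hint.re measurableSet_Ico fun s hs => ?_
  have e : Complex.I * s * t = ((s * t : ℝ) : ℂ) * Complex.I := by push_cast; ring
  rw [e, Complex.exp_ofReal_mul_I_re]
  have h3 : |s * t| ≤ 1 := by
    rw [abs_mul]
    have h4 : |s| ≤ 1 / 4 := (abs_le.2 ⟨hs.1, hs.2.le⟩).trans h1
    calc |s| * |t| ≤ 1 / 4 * 4 := by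
          gcongr
          exact ht.trans Real.pi_le_four
      _ = 1 := by norm_num
  have h5 : (s * t) ^ 2 ≤ 1 := by
    rw [← sq_abs]
    exact pow_le_one₀ (abs_nonneg _) h3
  linarith [Real.one_sub_sq_div_two_le_cos (x := s * t)]

/-- Multiplying by `boxMul h` integrates the moments over an interval. -/
lemma inner_expo_mul_boxMul (h t : ℝ) (u v : L2T) (huv : ∀ᵐ ξ ∂torus, u ξ = boxMul h ξ * v ξ) :
    inner ℂ (expo t) u = ∫ s in Set.Ico (-h) h, inner ℂ (expo (t + s)) v := by
  simp_rw [inner_expo]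
  rw [integral_integral_swap]
  · refine integral_congr_ae ?_
    filter_upwards [huv] with ξ hξ
    rw [hξ, integral_mul_const, boxMul, ← mul_assoc, ← integral_const_mul]
    congr 1
    refine integral_congr_ae (Eventually.of_forall fun s => ?_)
    simp only
    rw [← Complex.exp_add]
    congr 1
    push_cast
    ring
  · refine Integrable.bdd_mul (c := 1)
      (((Lp.memLp v).integrable (by norm_num)).comp_snd (volume.restrict (Set.Ico (-h) h))) ?_ ?_
    · exact (by fun_prop : Continuous fun p : ℝ × ℝ =>
        Complex.exp (Complex.I * (t + p.1 : ℝ) * p.2)).aestronglyMeasurable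
    · exact Eventually.of_forall fun p => (norm_exp_I_mul_real _ _).le

lemma lintegral_sq_pwFun_lt_top (u : L2T) : ∫⁻ t, ‖inner ℂ (expo t) u‖ₑ ^ (2 : ℝ) < ∞ := by
  have h := ((memLp_pwFun u).const_mul sqrtTwoPi).2
  have e : (fun t => sqrtTwoPi * pwFun u t) = fun t => inner ℂ (expo t) u := by
    funext t
    rw [pwFun, mul_inv_cancel_left₀ sqrtTwoPi_ne_zero]
  rw [e] at h
  have h2 := eLpNorm_nnreal_pow_eq_lintegral (μ := (volume : Measure ℝ))
    (f := fun t => inner ℂ (expo t) u) (p := 2) (by norm_num)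
  rw [NNReal.coe_ofNat] at h2
  rw [← h2]
  exact ENNReal.rpow_lt_top_of_nonneg (by norm_num) h.ne

/-- For separated points, the moments of any `u ∈ L₂(𝕋)` are square summable.  The moment of `u`
at `x j` is the integral, over an interval of length `2h` around `x j`, of the moments of
`v = u / boxMul h`.  These intervals are disjoint, and the moments of `v` are square integrable over
the line. -/
lemma tsum_sq_inner_expo_lt_top {x : ℤ → ℝ} {δ : ℝ} (hδ : 0 < δ)
    (hx : ∀ i j, i ≠ j → δ ≤ |x i - x j|) (u : L2T) :
    ∑' j, ‖inner ℂ (expo (x j)) u‖ₑ ^ (2 : ℝ) < ∞ := by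
  -- `2h ≤ δ` makes the intervals disjoint, `h ≤ 1/4` keeps the multiplier away from zero on `𝕋`
  set h : ℝ := min (δ / 2) (1 / 4) with hh
  have h0 : 0 < h := lt_min (by linarith) (by norm_num)
  have h1 : h ≤ 1 / 4 := min_le_right _ _
  have h2 : 2 * h ≤ δ := by linarith [min_le_left (δ / 2) (1 / 4 : ℝ)]
  have hne : ∀ᵐ ξ ∂torus, h ≤ ‖boxMul h ξ‖ := by
    filter_upwards [ae_abs_le_pi] with ξ hξ
    exact le_norm_boxMul h0 h1 hξ
  have hW : IsWeightedComp torus torus (fun ξ => (boxMul h ξ)⁻¹) id h⁻¹ := by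
    refine isWeightedComp_mul
      ((continuous_boxMul h).measurable.inv.aestronglyMeasurable) ?_
    rw [eLpNorm_exponent_top]
    refine eLpNormEssSup_le_of_ae_bound ?_
    filter_upwards [hne] with ξ hξ
    rw [norm_inv]
    exact inv_anti₀ h0 hξ
  set v : L2T := hW.toCLM u with hv
  have huv : ∀ᵐ ξ ∂torus, u ξ = boxMul h ξ * v ξ := by
    filter_upwards [hW.coeFn_toCLM u, hne] with ξ h3 h4
    have h5 : boxMul h ξ ≠ 0 := fun h6 => by
      rw [h6, norm_zero] at h4
      linarith
    rw [hv, h3, mul_inv_cancel_left₀ h5, id]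
  set g : ℝ → ℂ := fun t => inner ℂ (expo t) v with hg
  have hgc : Continuous g := continuous_expo.inner continuous_const
  set I : ℤ → Set ℝ := fun j => Set.Ico (x j - h) (x j + h) with hI
  have hterm : ∀ j, ‖inner ℂ (expo (x j)) u‖ₑ ^ (2 : ℝ)
      ≤ (∫⁻ t in I j, ‖g t‖ₑ ^ (2 : ℝ)) * ENNReal.ofReal (2 * h) := by
    intro j
    have e1 : inner ℂ (expo (x j)) u = ∫ t in I j, g t := by
      rw [inner_expo_mul_boxMul h (x j) u v huv]
      have := (measurePreserving_add_left (volume : Measure ℝ) (x j)).setIntegral_preimage_emb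
        (MeasurableEquiv.addLeft (x j)).measurableEmbedding g (I j)
      rw [← this, hI]
      simp only [Set.preimage_const_add_Ico]
      congr 3 <;> ring
    rw [e1]
    have e2 : ‖∫ t in I j, g t‖ₑ ≤ eLpNorm g 1 (volume.restrict (I j)) := by
      rw [eLpNorm_one_eq_lintegral_enorm]
      exact enorm_integral_le_lintegral_enorm _
    have e3 := eLpNorm_le_eLpNorm_mul_rpow_measure_univ (μ := volume.restrict (I j)) (f := g)
      (p := 1) (q := 2) (by norm_num) hgc.aestronglyMeasurable
    have e4 := eLpNorm_nnreal_pow_eq_lintegral (μ := volume.restrict (I j))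
      (f := g) (p := 2) (by norm_num)
    rw [NNReal.coe_ofNat] at e4
    rw [← e4]
    refine (ENNReal.rpow_le_rpow (e2.trans e3) (by norm_num)).trans_eq ?_
    rw [ENNReal.mul_rpow_of_nonneg _ _ (by norm_num), ← ENNReal.rpow_mul]
    congr 1
    rw [Measure.restrict_apply_univ, hI, Real.volume_Ico]
    have e5 : (1 / (1 : ℝ≥0∞).toReal - 1 / (2 : ℝ≥0∞).toReal) * 2 = 1 := by norm_num
    rw [e5, ENNReal.rpow_one]
    congr 1
    ring
  refine (ENNReal.tsum_le_tsum hterm).trans_lt ?_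
  rw [ENNReal.tsum_mul_right, ← lintegral_iUnion (fun j => measurableSet_Ico)]
  · refine ENNReal.mul_lt_top ?_ ENNReal.ofReal_lt_top
    exact (setLIntegral_le_lintegral _ _).trans_lt (lintegral_sq_pwFun_lt_top v)
  · intro i j hij
    refine Set.disjoint_left.2 fun t h3 h4 => ?_
    have h5 := hx i j hij
    have h6 : |x i - x j| < 2 * h := abs_lt.2
      ⟨by linarith [h3.1, h3.2, h4.1, h4.2], by linarith [h3.1, h3.2, h4.1, h4.2]⟩
    linarith

/-! ### The Riesz basis of exponentials and the prolongation operators -/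

lemma IsCIS.memℓp_moments {x : ℤ → ℝ} (hx : IsCIS x) (u : L2T) :
    Memℓp (fun j => inner ℂ (expo (x j)) u) 2 := by
  obtain ⟨δ, hδ, hsep⟩ := hx.separated
  have h := ENNReal.summable_toReal (tsum_sq_inner_expo_lt_top hδ hsep u).ne
  refine memℓp_gen ?_
  simpa [← ENNReal.toReal_rpow] using h

/-- The exponentials of a complete interpolating sequence form a Riesz basis of `L₂(𝕋)`: the
synthesis operator `c ↦ ∑ c_j exp(-i x_j ·)` is an isomorphism from `ℓ₂` onto `L₂(𝕋)`, being the
adjoint of the isomorphism `u ↦ (⟨exp(-i x_j ·), u⟩)_j`. -/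
lemma IsCIS.exists_synthesis {x : ℤ → ℝ} (hx : IsCIS x) :
    ∃ E : Ell2 ≃L[ℂ] L2T, ∀ c : Ell2, HasSum (fun j => c j • expo (x j)) (E c) := by
  obtain ⟨S, hS⟩ := hx.exists_solution
  let R : Ell2 ≃L[ℂ] L2T := ContinuousLinearEquiv.ofBijective S
    (LinearMap.ker_eq_bot'.2 fun c hc => by
      ext j
      rw [← hS c j]
      rw [show S c = 0 from hc, inner_zero_right]
      rfl)
    (LinearMap.range_eq_top.2 fun u => ⟨⟨_, hx.memℓp_moments u⟩,
      hx.eq_of_inner_expo fun j => hS _ j⟩)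
  have hR : ∀ u j, R.symm u j = inner ℂ (expo (x j)) u := fun u j => by
    have h1 : S (R.symm u) = u := R.apply_symm_apply u
    rw [← hS, h1]
  let A : L2T →L[ℂ] Ell2 := R.symm
  let E : Ell2 ≃L[ℂ] L2T := ContinuousLinearEquiv.equivOfInverse
    (ContinuousLinearMap.adjoint A) (ContinuousLinearMap.adjoint (R : Ell2 →L[ℂ] L2T))
    (fun c => by
      rw [← ContinuousLinearMap.comp_apply, ← ContinuousLinearMap.adjoint_comp]
      have : A ∘L (R : Ell2 →L[ℂ] L2T) = ContinuousLinearMap.id ℂ Ell2 := by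
        ext1 c
        exact R.symm_apply_apply c
      rw [this, ContinuousLinearMap.adjoint_id]
      rfl)
    (fun u => by
      rw [← ContinuousLinearMap.comp_apply, ← ContinuousLinearMap.adjoint_comp]
      have : (R : Ell2 →L[ℂ] L2T) ∘L A = ContinuousLinearMap.id ℂ L2T := by
        ext1 u
        exact R.apply_symm_apply u
      rw [this, ContinuousLinearMap.adjoint_id]
      rfl)
  refine ⟨E, fun c => ?_⟩
  have h1 := (E : Ell2 →L[ℂ] L2T).hasSum (lp.hasSum_single (by norm_num) c)
  convert h1 using 2 with j
  swap
  · rfl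
  refine ext_inner_right ℂ fun u => ?_
  change _ = inner ℂ (ContinuousLinearMap.adjoint A (lp.single 2 j (c j))) u
  rw [ContinuousLinearMap.adjoint_inner_left, lp.inner_single_left, inner_smul_left]
  change _ = inner ℂ (c j) (R.symm u j)
  rw [hR, RCLike.inner_apply, mul_comm]

/-- Multiplication of a square summable sequence by a unimodular one. -/
lemma exists_diag (a : ℤ → ℂ) (ha : ∀ j, ‖a j‖ = 1) :
    ∃ D : Ell2 →L[ℂ] Ell2, ‖D‖ ≤ 1 ∧ ∀ c j, D c j = a j * c j := by
  have hmem : ∀ c : Ell2, Memℓp (fun j => a j * c j) 2 := fun c => by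
    refine memℓp_gen ?_
    simpa [norm_mul, ha] using (lp.memℓp c).summable (by norm_num)
  let L : Ell2 →ₗ[ℂ] Ell2 :=
    { toFun := fun c => ⟨_, hmem c⟩
      map_add' := fun c d => by
        ext j
        exact mul_add _ _ _
      map_smul' := fun r c => by
        ext j
        simp [mul_left_comm] }
  have hL : ∀ c, ‖L c‖ ≤ 1 * ‖c‖ := fun c => by
    have h2 : 0 < (2 : ℝ≥0∞).toReal := by norm_num
    rw [one_mul, ← Real.rpow_le_rpow_iff (norm_nonneg _) (norm_nonneg _) h2,
      lp.norm_rpow_eq_tsum h2, lp.norm_rpow_eq_tsum h2]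
    refine le_of_eq (tsum_congr fun j => ?_)
    change ‖a j * c j‖ ^ _ = _
    rw [norm_mul, ha, one_mul]
  exact ⟨L.mkContinuous 1 hL, L.mkContinuous_norm_le zero_le_one hL, fun c j => rfl⟩

/-- The exponentials of a complete interpolating sequence span a dense subspace of `L₂(𝕋)`. -/
lemma IsCIS.dense_span {x : ℤ → ℝ} (hx : IsCIS x) :
    Dense (Submodule.span ℂ (Set.range fun j => expo (x j)) : Set L2T) := by
  rw [Submodule.dense_iff_topologicalClosure_eq_top, Submodule.topologicalClosure_eq_top_iff,
    Submodule.eq_bot_iff]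
  intro u hu
  refine hx.eq_of_inner_expo fun j => ?_
  rw [inner_zero_right]
  exact (Submodule.mem_orthogonal _ _).1 hu _ (Submodule.subset_span ⟨j, rfl⟩)

/-- The prolongation operators of a complete interpolating sequence are linear and uniformly
bounded. -/
lemma IsCIS.exists_prolong {x : ℤ → ℝ} (hx : IsCIS x) :
    ∃ (P : ℤ → L2T →L[ℂ] L2T) (C : ℝ), (∀ k h, prolong x k h = P k h) ∧ (∀ k, ‖P k‖ ≤ C) ∧
      (∀ k j, P k (expo (x j)) = Complex.exp (-Complex.I * x j * (2 * Real.pi * k)) • expo (x j)) ∧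
      P 0 = ContinuousLinearMap.id ℂ L2T := by
  obtain ⟨E, hE⟩ := hx.exists_synthesis
  have ha : ∀ k j : ℤ, ‖Complex.exp (-Complex.I * x j * (2 * Real.pi * k))‖ = 1 := fun k j => by
    have e : -Complex.I * x j * (2 * Real.pi * k) = ((-x j * (2 * Real.pi * k) : ℝ) : ℂ) *
        Complex.I := by push_cast; ring
    rw [e, Complex.norm_exp_ofReal_mul_I]
  choose D hDn hD using fun k : ℤ => exists_diag _ (ha k)
  have hP : ∀ k j, E (D k (E.symm (expo (x j))))
      = Complex.exp (-Complex.I * x j * (2 * Real.pi * k)) • expo (x j) := fun k j => by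
    have h1 : E (lp.single (E := fun _ : ℤ => ℂ) 2 j 1) = expo (x j) := by
      refine (hE _).unique ?_
      convert hasSum_ite_eq j (expo (x j)) using 2 with i
      split_ifs with hij
      · rw [hij, lp.single_apply_self, one_smul]
      · rw [lp.single_apply_ne _ _ _ hij, zero_smul]
    have h2 : D k (lp.single (E := fun _ : ℤ => ℂ) 2 j 1)
        = Complex.exp (-Complex.I * x j * (2 * Real.pi * k)) •
          lp.single (E := fun _ : ℤ => ℂ) 2 j 1 := by
      ext i
      rw [hD]
      change _ = _ * lp.single (E := fun _ : ℤ => ℂ) 2 j 1 i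
      by_cases hij : i = j
      · rw [hij]
      · rw [lp.single_apply_ne _ _ _ hij, mul_zero, mul_zero]
    rw [← h1, E.symm_apply_apply, h2, map_smul]
  have hco : ∀ h, coeffs x h = E.symm h := fun h => by
    have H : ∃ c : ℤ → ℂ, Memℓp c 2 ∧ HasSum (fun j => c j • expo (x j)) h :=
      ⟨E.symm h, (E.symm h).2, by simpa using hE (E.symm h)⟩
    rw [coeffs, dif_pos H]
    obtain ⟨h1, h2⟩ := H.choose_spec
    have h3 : E ⟨_, h1⟩ = h := (hE ⟨_, h1⟩).unique h2
    have h4 : (⟨_, h1⟩ : Ell2) = E.symm h := E.injective (h3.trans (E.apply_symm_apply h).symm)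
    exact congrArg Subtype.val h4
  refine ⟨fun k => (E : Ell2 →L[ℂ] L2T) ∘L D k ∘L (E.symm : L2T →L[ℂ] Ell2),
    ‖(E : Ell2 →L[ℂ] L2T)‖ * (1 * ‖(E.symm : L2T →L[ℂ] Ell2)‖), fun k h => ?_, fun k => ?_, hP, ?_⟩
  · have h1 := hE (D k (E.symm h))
    rw [prolong, hco]
    refine (HasSum.tsum_eq ?_)
    convert h1 using 3 with j
    · rw [hD, mul_comm]
    · rfl
  · refine (ContinuousLinearMap.opNorm_comp_le _ _).trans ?_
    gcongr
    refine (ContinuousLinearMap.opNorm_comp_le _ _).trans ?_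
    gcongr
    exact hDn k
  · refine ContinuousLinearMap.ext_on hx.dense_span ?_
    rintro _ ⟨j, rfl⟩
    refine (hP 0 j).trans ?_
    simp

/-- The prolongation operator of a complete interpolating sequence as a bounded operator. -/
def IsCIS.prol {x : ℤ → ℝ} (hx : IsCIS x) : ℤ → L2T →L[ℂ] L2T := hx.exists_prolong.choose

/-- A common bound for the norms of all prolongation operators. -/
def IsCIS.bound {x : ℤ → ℝ} (hx : IsCIS x) : ℝ := hx.exists_prolong.choose_spec.choose

namespace IsCIS

variable {x : ℤ → ℝ} (hx : IsCIS x)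

lemma prolong_eq (k : ℤ) (h : L2T) : prolong x k h = hx.prol k h :=
  hx.exists_prolong.choose_spec.choose_spec.1 k h

lemma norm_prol_le (k : ℤ) : ‖hx.prol k‖ ≤ hx.bound :=
  hx.exists_prolong.choose_spec.choose_spec.2.1 k

lemma prol_expo (k j : ℤ) : hx.prol k (expo (x j))
    = Complex.exp (-Complex.I * x j * (2 * Real.pi * k)) • expo (x j) :=
  hx.exists_prolong.choose_spec.choose_spec.2.2.1 k j

lemma prol_zero : hx.prol 0 = ContinuousLinearMap.id ℂ L2T :=
  hx.exists_prolong.choose_spec.choose_spec.2.2.2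

lemma bound_nonneg : 0 ≤ hx.bound := (norm_nonneg _).trans (hx.norm_prol_le 0)

/-- The adjoint of prolongation: the sampling operator at `x`, applied to the blocks of a Fourier
transform. -/
def sample (w : ℤ → L2T) : L2T := ∑' k, ContinuousLinearMap.adjoint (hx.prol k) (w k)

lemma norm_adjoint_prol_le (k : ℤ) (u : L2T) :
    ‖ContinuousLinearMap.adjoint (hx.prol k) u‖ ≤ hx.bound * ‖u‖ :=
  ContinuousLinearMap.le_of_opNorm_le _ (by simpa using hx.norm_prol_le k) u

lemma hasSum_sample {w : ℤ → L2T} (hw : Summable fun k => ‖w k‖) :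
    HasSum (fun k => ContinuousLinearMap.adjoint (hx.prol k) (w k)) (hx.sample w) :=
  (Summable.of_norm_bounded (hw.mul_left hx.bound) fun k =>
    hx.norm_adjoint_prol_le k (w k)).hasSum

lemma sample_sub {w w' : ℤ → L2T} (hw : Summable fun k => ‖w k‖)
    (hw' : Summable fun k => ‖w' k‖) :
    hx.sample (fun k => w k - w' k) = hx.sample w - hx.sample w' := by
  refine HasSum.tsum_eq ?_
  simpa using (hx.hasSum_sample hw).sub (hx.hasSum_sample hw')

/-- The values at the points `x j` of a function with blocks `w` are the moments of
`hx.sample w`. -/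
lemma ofBlocks_apply {w : ℤ → L2T} (hw : Summable fun k => ‖w k‖) (j : ℤ) :
    ofBlocks w (x j) = sqrtTwoPi⁻¹ * inner ℂ (expo (x j)) (hx.sample w) := by
  rw [ofBlocks]
  congr 1
  refine HasSum.tsum_eq ?_
  have h1 := (innerSL ℂ (expo (x j))).hasSum (hx.hasSum_sample hw)
  refine h1.congr_fun ?_
  intro k
  rw [innerSL_apply_apply, ContinuousLinearMap.adjoint_inner_right, hx.prol_expo, inner_smul_left,
    ← Complex.exp_conj]
  congr 2
  simp only [map_mul, map_neg, Complex.conj_I, Complex.conj_ofReal, neg_neg, map_ofNat,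
    map_intCast]

/-- Functions with blocks `w` and `w'` agree at the points `x j` if and only if the sampling
operator does not distinguish `w` and `w'`. -/
lemma forall_ofBlocks_eq_iff {w w' : ℤ → L2T} (hw : Summable fun k => ‖w k‖)
    (hw' : Summable fun k => ‖w' k‖) :
    (∀ j, ofBlocks w (x j) = ofBlocks w' (x j)) ↔ hx.sample w = hx.sample w' := by
  refine ⟨fun h => hx.eq_of_inner_expo fun j => ?_, fun h j => ?_⟩
  · have h1 := h j
    rw [hx.ofBlocks_apply hw, hx.ofBlocks_apply hw'] at h1
    exact mul_left_cancel₀ (inv_ne_zero sqrtTwoPi_ne_zero) h1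
  · rw [hx.ofBlocks_apply hw, hx.ofBlocks_apply hw', h]

end IsCIS

/-! ### The multipliers of a generator -/

section Generator

variable {φ : ℝ → ℂ}

lemma blockNorm_lt_top (h : CondA1 φ ∧ CondA2 φ) (k : ℤ) : blockNorm φ k < ∞ :=
  (ENNReal.le_tsum k).trans_lt h.2.1

lemma delta_lt_top (h : CondA1 φ ∧ CondA2 φ) : delta φ < ∞ := by
  have h1 := blockNorm_lt_top h 0
  have h0 : torus ≠ 0 := fun h0 => by
    have := torus_univ
    rw [h0] at this
    simp [Real.pi_pos.not_ge] at this
  have : NeBot (ae torus) := ae_neBot.2 h0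
  rw [blockNorm, eLpNorm_exponent_top, eLpNormEssSup] at h1
  simp only [Int.cast_zero, mul_zero, add_zero] at h1
  refine lt_of_le_of_lt ?_ h1
  exact liminf_le_limsup

lemma delta_toReal_pos (h : CondA1 φ ∧ CondA2 φ) : 0 < (delta φ).toReal :=
  ENNReal.toReal_pos h.2.2.1.ne' (delta_lt_top h).ne

lemma ae_delta_le (φ : ℝ → ℂ) : ∀ᵐ ξ ∂torus, (delta φ).toReal ≤ ‖ft φ ξ‖ := by
  have h1 : ∀ᵐ ξ ∂torus, delta φ ≤ ‖ft φ ξ‖ₑ := ae_essInf_le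
  filter_upwards [h1] with ξ hξ
  simpa using ENNReal.toReal_mono enorm_ne_top hξ

lemma aestronglyMeasurable_ft_tile (h : CondA1 φ ∧ CondA2 φ) (k : ℤ) :
    AEStronglyMeasurable (fun ξ => ft φ (ξ + 2 * Real.pi * k)) torus :=
  ((aestronglyMeasurable_ft h.1.1).comp_quasiMeasurePreserving
    (measurePreserving_add_right volume (2 * Real.pi * k)).quasiMeasurePreserving).restrict

lemma isWeightedComp_opT (h : CondA1 φ ∧ CondA2 φ) (k : ℤ) : IsWeightedComp torus torus
    (fun ξ => ((delta φ).toReal : ℂ)⁻¹ * ft φ (ξ + 2 * Real.pi * k)) id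
    (blockNorm φ k / delta φ).toReal := by
  refine isWeightedComp_mul ((aestronglyMeasurable_ft_tile h k).const_mul _) ?_
  have e : (fun ξ => ((delta φ).toReal : ℂ)⁻¹ * ft φ (ξ + 2 * Real.pi * k))
      = ((delta φ).toReal : ℂ)⁻¹ • fun ξ => ft φ (ξ + 2 * Real.pi * k) := rfl
  rw [e, eLpNorm_const_smul, ENNReal.ofReal_toReal
    (ENNReal.div_ne_top (blockNorm_lt_top h k).ne h.2.2.1.ne'), enorm_inv
    (by simpa using (delta_toReal_pos h).ne'), div_eq_mul_inv, mul_comm]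
  refine le_of_eq ?_
  congr 2
  rw [← ofReal_norm, Complex.norm_real, Real.norm_of_nonneg ENNReal.toReal_nonneg,
    ENNReal.ofReal_toReal (delta_lt_top h).ne]

lemma isWeightedComp_opM (h : CondA1 φ ∧ CondA2 φ) : IsWeightedComp torus torus
    (fun ξ => ((delta φ).toReal : ℂ) / ft φ ξ) id 1 := by
  have hm := aestronglyMeasurable_ft_tile h 0
  simp only [Int.cast_zero, mul_zero, add_zero] at hm
  refine isWeightedComp_mul (aestronglyMeasurable_const.div₀ hm) ?_
  rw [eLpNorm_exponent_top]
  refine eLpNormEssSup_le_of_ae_bound ?_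
  filter_upwards [ae_delta_le φ] with ξ hξ
  rw [norm_div, Complex.norm_real, Real.norm_of_nonneg ENNReal.toReal_nonneg]
  exact div_le_one_of_le₀ hξ (norm_nonneg _)

/-- The multiplier `T_{φ,k}`, given by `δ_φ⁻¹ φ̂(· + 2πk)`, as a bounded operator. -/
def genT (h : CondA1 φ ∧ CondA2 φ) (k : ℤ) : L2T →L[ℂ] L2T := (isWeightedComp_opT h k).toCLM

/-- The multiplier `M_φ`, given by `δ_φ / φ̂`, as a bounded operator. -/
def genM (h : CondA1 φ ∧ CondA2 φ) : L2T →L[ℂ] L2T := (isWeightedComp_opM h).toCLM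

lemma opT_eq (h : CondA1 φ ∧ CondA2 φ) (k : ℤ) (g : L2T) : opT φ k g = genT h k g := by
  rw [opT, mulBy]
  exact dif_pos ((isWeightedComp_opT h k) g (Lp.memLp g)).1

lemma opM_eq (h : CondA1 φ ∧ CondA2 φ) (g : L2T) : opM φ g = genM h g := by
  rw [opM, mulBy]
  exact dif_pos ((isWeightedComp_opM h) g (Lp.memLp g)).1

lemma coeFn_genT (h : CondA1 φ ∧ CondA2 φ) (k : ℤ) (g : L2T) : (genT h k g : ℝ → ℂ) =ᵐ[torus]
    fun ξ => ((delta φ).toReal : ℂ)⁻¹ * ft φ (ξ + 2 * Real.pi * k) * g ξ :=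
  (isWeightedComp_opT h k).coeFn_toCLM g

lemma coeFn_genM (h : CondA1 φ ∧ CondA2 φ) (g : L2T) : (genM h g : ℝ → ℂ) =ᵐ[torus]
    fun ξ => ((delta φ).toReal : ℂ) / ft φ ξ * g ξ :=
  (isWeightedComp_opM h).coeFn_toCLM g

lemma ae_ft_ne_zero (h : CondA1 φ ∧ CondA2 φ) : ∀ᵐ ξ ∂torus, ft φ ξ ≠ 0 := by
  filter_upwards [ae_delta_le φ] with ξ hξ
  exact norm_pos_iff.1 ((delta_toReal_pos h).trans_le hξ)

lemma genT_genM (h : CondA1 φ ∧ CondA2 φ) (g : L2T) : genT h 0 (genM h g) = g := by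
  refine Lp.ext ?_
  filter_upwards [coeFn_genT h 0 (genM h g), coeFn_genM h g, ae_ft_ne_zero h] with ξ h1 h2 h3
  have h4 : ((delta φ).toReal : ℂ) ≠ 0 := Complex.ofReal_ne_zero.2 (delta_toReal_pos h).ne'
  rw [h1, h2]
  simp only [Int.cast_zero, mul_zero, add_zero]
  field_simp

lemma genM_genT (h : CondA1 φ ∧ CondA2 φ) (g : L2T) : genM h (genT h 0 g) = g := by
  refine Lp.ext ?_
  filter_upwards [coeFn_genT h 0 g, coeFn_genM h (genT h 0 g), ae_ft_ne_zero h] with ξ h1 h2 h3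
  have h4 : ((delta φ).toReal : ℂ) ≠ 0 := Complex.ofReal_ne_zero.2 (delta_toReal_pos h).ne'
  rw [h2, h1]
  simp only [Int.cast_zero, mul_zero, add_zero]
  field_simp

lemma norm_genT_le (h : CondA1 φ ∧ CondA2 φ) (k : ℤ) :
    ‖genT h k‖ ≤ (blockNorm φ k / delta φ).toReal :=
  (isWeightedComp_opT h k).norm_toCLM_le ENNReal.toReal_nonneg

lemma enorm_genT_le (h : CondA1 φ ∧ CondA2 φ) (k : ℤ) (g : L2T) :
    ‖genT h k g‖ₑ ≤ blockNorm φ k / delta φ * ‖g‖ₑ := by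
  have h1 := (genT h k).le_of_opNorm_le (norm_genT_le h k) g
  have h2 := ENNReal.ofReal_le_ofReal h1
  rwa [ENNReal.ofReal_mul ENNReal.toReal_nonneg, ENNReal.ofReal_toReal
    (ENNReal.div_ne_top (blockNorm_lt_top h k).ne h.2.2.1.ne'), ofReal_norm, ofReal_norm] at h2

lemma summable_norm_genT (h : CondA1 φ ∧ CondA2 φ) : Summable fun k => ‖genT h k‖ := by
  refine Summable.of_nonneg_of_le (fun _ => norm_nonneg _) (norm_genT_le h) ?_
  refine ENNReal.summable_toReal ?_
  simp_rw [div_eq_mul_inv]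
  rw [ENNReal.tsum_mul_right]
  exact ENNReal.mul_ne_top h.2.1.ne (ENNReal.inv_ne_top.2 h.2.2.1.ne')

open scoped ComplexOrder in
lemma re_inner_genT_nonneg (h : CondA1 φ ∧ CondA2 φ) (k : ℤ) (g : L2T) :
    0 ≤ (inner ℂ g (genT h k g)).re := by
  rw [L2.inner_def]
  have h1 : (∫ ξ, inner ℂ (g ξ) (genT h k g ξ) ∂torus).re
      = ∫ ξ, (inner ℂ (g ξ) (genT h k g ξ)).re ∂torus :=
    (integral_re (L2.integrable_inner (𝕜 := ℂ) g (genT h k g))).symm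
  rw [h1]
  refine integral_nonneg_of_ae ?_
  filter_upwards [coeFn_genT h k g, ae_tile_of_ae (ft_nonneg h.1 h.2) k] with ξ h2 h3
  obtain ⟨h4, h5⟩ := Complex.nonneg_iff.1 h3
  have h6 : ft φ (ξ + 2 * Real.pi * k) = ((ft φ (ξ + 2 * Real.pi * k)).re : ℂ) :=
    Complex.ext rfl h5.symm
  rw [h2, RCLike.inner_apply, h6, mul_assoc, mul_assoc, RCLike.mul_conj, ← Complex.ofReal_inv]
  have h7 : ((delta φ).toReal⁻¹ : ℂ) * (((ft φ (ξ + 2 * Real.pi * k)).re : ℂ) *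
      ((‖g ξ‖ : ℝ) : ℂ) ^ 2) = (((delta φ).toReal⁻¹ * ((ft φ (ξ + 2 * Real.pi * k)).re *
        ‖g ξ‖ ^ 2) : ℝ) : ℂ) := by push_cast; rfl
  have h8 : (0 : ℝ) ≤ (delta φ).toReal⁻¹ := inv_nonneg.2 ENNReal.toReal_nonneg
  have h9 : (0 : ℝ) ≤ (delta φ).toReal⁻¹ * ((ft φ (ξ + 2 * Real.pi * k)).re * ‖g ξ‖ ^ 2) := by
    positivity
  rw [← Complex.ofReal_inv] at h7
  exact (congrArg Complex.re h7).symm ▸ h9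

open scoped ComplexOrder in
lemma le_re_inner_genT_zero (h : CondA1 φ ∧ CondA2 φ) (g : L2T) :
    ‖g‖ ^ 2 ≤ (inner ℂ g (genT h 0 g)).re := by
  have e : ‖g‖ ^ 2 = (inner ℂ g g).re := (inner_self_eq_norm_sq (𝕜 := ℂ) g).symm
  rw [e, L2.inner_def, L2.inner_def]
  have h1 : (∫ ξ, inner ℂ (g ξ) (genT h 0 g ξ) ∂torus).re
      = ∫ ξ, (inner ℂ (g ξ) (genT h 0 g ξ)).re ∂torus :=
    (integral_re (L2.integrable_inner (𝕜 := ℂ) g (genT h 0 g))).symm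
  have h1' : (∫ ξ, inner ℂ (g ξ) (g ξ) ∂torus).re
      = ∫ ξ, (inner ℂ (g ξ) (g ξ)).re ∂torus :=
    (integral_re (L2.integrable_inner (𝕜 := ℂ) g g)).symm
  rw [h1, h1']
  refine integral_mono_ae (L2.integrable_inner (𝕜 := ℂ) g g).re
    (L2.integrable_inner (𝕜 := ℂ) g (genT h 0 g)).re ?_
  filter_upwards [coeFn_genT h 0 g, ae_tile_of_ae (ft_nonneg h.1 h.2) 0, ae_delta_le φ]
    with ξ h2 h3 h3'
  simp only [Int.cast_zero, mul_zero, add_zero] at h2 h3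
  obtain ⟨h4, h5⟩ := Complex.nonneg_iff.1 h3
  have h6 : ft φ ξ = ((ft φ ξ).re : ℂ) := Complex.ext rfl h5.symm
  rw [h6, Complex.norm_real, Real.norm_of_nonneg h4] at h3'
  have h7 : inner ℂ (g ξ) (genT h 0 g ξ)
      = (((delta φ).toReal⁻¹ * (ft φ ξ).re * ‖g ξ‖ ^ 2 : ℝ) : ℂ) := by
    rw [h2, RCLike.inner_apply, h6, mul_assoc, RCLike.mul_conj]
    push_cast
    rfl
  have h8 : inner ℂ (g ξ) (g ξ) = ((‖g ξ‖ ^ 2 : ℝ) : ℂ) := by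
    rw [inner_self_eq_norm_sq_to_K]
    push_cast
    rfl
  rw [h7, h8, Complex.ofReal_re, Complex.ofReal_re]
  refine le_mul_of_one_le_left (sq_nonneg _) ?_
  rw [inv_mul_eq_div, one_le_div (delta_toReal_pos h)]
  exact h3'

end Generator

/-! ### The spaces `V(φ, x)` in terms of Fourier blocks -/

section Space

variable {φ : ℝ → ℂ} {x : ℤ → ℝ}

lemma summable_gen (h : CondA1 φ ∧ CondA2 φ) (hx : IsCIS x) (v : L2T) :
    Summable fun k => ‖genT h k (hx.prol k v)‖ := by
  refine Summable.of_nonneg_of_le (fun _ => norm_nonneg _) (fun k => ?_)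
    ((summable_norm_genT h).mul_right (hx.bound * ‖v‖))
  refine ((genT h k).le_opNorm _).trans ?_
  gcongr
  exact (hx.prol k).le_of_opNorm_le (hx.norm_prol_le k) v

/-- The element of `V(φ, x)` with coefficient function `v`, up to the factor `δ_φ`: its `k`-th
block is `T_{φ,k} A_x^k v`. -/
def gen (h : CondA1 φ ∧ CondA2 φ) (hx : IsCIS x) (v : L2T) : L2R :=
  glue fun k => genT h k (hx.prol k v)

lemma block_gen (h : CondA1 φ ∧ CondA2 φ) (hx : IsCIS x) (v : L2T) (k : ℤ) :
    block k (gen h hx v) = genT h k (hx.prol k v) :=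
  block_glue (summable_gen h hx v) k

/-- The moments of the blocks of `φ` in terms of the multipliers `T_{φ,k}`: a shift by `s` on one
side is an exponential on the other. -/
lemma inner_expo_block (h : CondA1 φ ∧ CondA2 φ) (k : ℤ) (s t : ℝ) :
    inner ℂ (expo (t - s)) (block k (h.1.1.toLp φ))
      = (delta φ).toReal * inner ℂ (expo t) (genT h k (expo s)) := by
  rw [inner_expo, inner_expo, ← integral_const_mul]
  refine integral_congr_ae ?_
  filter_upwards [coeFn_block_toLp h.1.1 k, coeFn_genT h k (expo s), coeFn_expo s] with ξ h1 h2 h3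
  have h4 : ((delta φ).toReal : ℂ) ≠ 0 := Complex.ofReal_ne_zero.2 (delta_toReal_pos h).ne'
  rw [h1, h2, h3]
  have e : Complex.exp (Complex.I * (t - s : ℝ) * ξ)
      = Complex.exp (Complex.I * t * ξ) * Complex.exp (-Complex.I * s * ξ) := by
    rw [← Complex.exp_add]
    congr 1
    push_cast
    ring
  rw [e]
  field_simp

lemma summable_block_toLp (h : CondA1 φ ∧ CondA2 φ) :
    Summable fun k => ‖block k (h.1.1.toLp φ)‖ := by
  refine Summable.of_nonneg_of_le (fun _ => norm_nonneg _) (fun k => ?_)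
    ((ENNReal.summable_toReal h.2.1.ne).mul_left (Real.sqrt (2 * Real.pi)))
  refine norm_le_of_ae_bound_torus ENNReal.toReal_nonneg ?_
  have h1 := ae_le_eLpNormEssSup (μ := torus) (f := fun ξ => ft φ (ξ + 2 * Real.pi * k))
  filter_upwards [coeFn_block_toLp h.1.1 k, h1] with ξ h2 h3
  rw [h2, ← toReal_enorm]
  refine ENNReal.toReal_mono (blockNorm_lt_top h k).ne ?_
  rwa [blockNorm, eLpNorm_exponent_top]

/-- The translates `φ(· - x_j)` correspond to the exponentials `exp(-i x_j ·)`. -/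
lemma coeFn_gen_expo (h : CondA1 φ ∧ CondA2 φ) (hx : IsCIS x) (j : ℤ) :
    (((delta φ).toReal : ℂ) • gen h hx (expo (x j)) : L2R) =ᵐ[volume] fun t => φ (t - x j) := by
  have h1 : φ =ᵐ[volume] ofBlocks fun k => block k (h.1.1.toLp φ) :=
    h.1.1.coeFn_toLp.symm.trans (isContVersion_ofBlocks (summable_block_toLp h)).2
  have h2 := (measurePreserving_sub_right (volume : Measure ℝ)
    (x j)).quasiMeasurePreserving.ae_eq_comp h1
  have h3 : Summable fun k => ‖block k (gen h hx (expo (x j)))‖ := by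
    simp_rw [block_gen]
    exact summable_gen h hx _
  filter_upwards [Lp.coeFn_smul ((delta φ).toReal : ℂ) (gen h hx (expo (x j))), h2,
    (isContVersion_ofBlocks h3).2] with t h4 h5 h6
  simp only [Function.comp_apply] at h5
  rw [h4, Pi.smul_apply, h6, h5, ofBlocks, ofBlocks, smul_eq_mul, mul_left_comm,
    ← tsum_mul_left]
  congr 2
  funext k
  rw [block_gen, hx.prol_expo, map_smul, inner_smul_right, inner_expo_block h]
  have e : Complex.exp (Complex.I * (t - x j : ℝ) * (2 * Real.pi * k))
      = Complex.exp (Complex.I * t * (2 * Real.pi * k))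
        * Complex.exp (-Complex.I * x j * (2 * Real.pi * k)) := by
    rw [← Complex.exp_add]
    congr 1
    push_cast
    ring
  rw [e]
  ring

/-- The blocks of any `f ∈ V(φ, x)` are determined by the zeroth one. -/
lemma block_eq_of_mem_space (h : CondA1 φ ∧ CondA2 φ) (hx : IsCIS x) {f : L2R}
    (hf : f ∈ space φ x) (k : ℤ) :
    block k f = genT h k (hx.prol k (genM h (block 0 f))) := by
  let K : L2R →L[ℂ] L2T := block k - genT h k ∘L hx.prol k ∘L genM h ∘L block 0
  have hle : space φ x ≤ K.ker := by
    refine Submodule.topologicalClosure_minimal _ (Submodule.span_le.2 ?_) K.isClosed_ker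
    rintro f ⟨j, hj⟩
    have e : f = ((delta φ).toReal : ℂ) • gen h hx (expo (x j)) :=
      Lp.ext (hj.trans (coeFn_gen_expo h hx j).symm)
    change block k f - genT h k (hx.prol k (genM h (block 0 f))) = 0
    rw [e, (block k).map_smul, (block 0).map_smul, block_gen, block_gen, hx.prol_zero,
      ContinuousLinearMap.id_apply, (genM h).map_smul, genM_genT, (hx.prol k).map_smul,
      (genT h k).map_smul, sub_self]
  exact sub_eq_zero.1 (hle hf)

lemma summable_block_of_mem_space (h : CondA1 φ ∧ CondA2 φ) (hx : IsCIS x) {f : L2R}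
    (hf : f ∈ space φ x) : Summable fun k => ‖block k f‖ := by
  exact (summable_gen h hx _).congr fun k => by rw [← block_eq_of_mem_space h hx hf]

lemma gen_mem_space (h : CondA1 φ ∧ CondA2 φ) (hx : IsCIS x) (v : L2T) :
    gen h hx v ∈ space φ x := by
  have hs : Summable fun k => unblock k ∘L genT h k ∘L hx.prol k := by
    refine Summable.of_norm_bounded ((summable_norm_genT h).mul_right hx.bound) fun k => ?_
    refine ContinuousLinearMap.opNorm_le_bound _
      (mul_nonneg (norm_nonneg _) hx.bound_nonneg) fun u => ?_
    refine (norm_unblock_le k _).trans (((genT h k).le_opNorm _).trans ?_)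
    rw [mul_assoc]
    gcongr
    exact (hx.prol k).le_of_opNorm_le (hx.norm_prol_le k) u
  set R : L2T →L[ℂ] L2R := ∑' k, unblock k ∘L genT h k ∘L hx.prol k with hR
  have hRv : ∀ u, R u = gen h hx u := fun u => by
    have h1 := (ContinuousLinearMap.apply ℂ L2R u).hasSum hs.hasSum
    exact h1.unique (hasSum_glue (summable_gen h hx u))
  have hδ : ((delta φ).toReal : ℂ) ≠ 0 := Complex.ofReal_ne_zero.2 (delta_toReal_pos h).ne'
  have hcl : IsClosed {u : L2T | R u ∈ space φ x} :=
    (Submodule.isClosed_topologicalClosure _).preimage R.continuous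
  rw [← hRv]
  refine hcl.closure_subset_iff.2 ?_ (hx.dense_span v)
  change (Submodule.span ℂ (Set.range fun j => expo (x j)) : Set L2T)
    ⊆ ((space φ x).comap (R : L2T →ₗ[ℂ] L2R) : Set L2T)
  refine Submodule.span_le.2 ?_
  rintro _ ⟨j, rfl⟩
  change R (expo (x j)) ∈ space φ x
  rw [hRv, ← Submodule.smul_mem_iff _ hδ]
  exact Submodule.le_topologicalClosure _ (Submodule.subset_span ⟨j, coeFn_gen_expo h hx j⟩)

end Space

/-! ### Solving the interpolation problem -/

/-- A bounded operator `K` on a Hilbert space with `‖v‖² ≤ Re ⟨v, K v⟩` is bounded below by `1`. -/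
lemma norm_le_of_coercive {V : Type*} [NormedAddCommGroup V] [InnerProductSpace ℂ V] {K : V → V}
    (hK : ∀ v, ‖v‖ ^ 2 ≤ (inner ℂ v (K v)).re) (v : V) : ‖v‖ ≤ ‖K v‖ := by
  have h1 : ‖v‖ * ‖v‖ ≤ ‖v‖ * ‖K v‖ := by
    rw [← sq]
    exact (hK v).trans ((Complex.re_le_norm _).trans (norm_inner_le_norm _ _))
  rcases (norm_nonneg v).eq_or_lt with h0 | h0
  · rw [← h0]
    exact norm_nonneg _
  · exact le_of_mul_le_mul_left h1 h0

lemma surjective_of_coercive {V : Type*} [NormedAddCommGroup V] [InnerProductSpace ℂ V]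
    [CompleteSpace V] {K : V →L[ℂ] V} (hK : ∀ v, ‖v‖ ^ 2 ≤ (inner ℂ v (K v)).re) :
    Function.Surjective K := by
  have hanti : AntilipschitzWith 1 K := K.antilipschitz_of_bound fun v => by
    simpa using norm_le_of_coercive hK v
  have hcl : IsClosed (K.range : Set V) := by
    rw [LinearMap.coe_range]
    exact hanti.isClosed_range K.uniformContinuous
  have : CompleteSpace K.range := hcl.completeSpace_coe
  refine (LinearMap.range_eq_top (f := (K : V →ₗ[ℂ] V))).1 ?_
  rw [← Submodule.orthogonal_eq_bot_iff, Submodule.eq_bot_iff]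
  intro v hv
  have h1 : inner ℂ (K v) v = 0 := (Submodule.mem_orthogonal _ _).1 hv _ ⟨v, rfl⟩
  have h2 := hK v
  rw [← inner_conj_symm, h1, map_zero, Complex.zero_re] at h2
  exact norm_eq_zero.1 (pow_eq_zero_iff two_ne_zero |>.1 (le_antisymm h2 (sq_nonneg _)))

section Interpolation

variable {φ : ℝ → ℂ} {y : ℤ → ℝ}

/-- The interpolation operator `v ↦ ∑ (A_y^k)^* T_{φ,k} A_y^k v`, which sends the coefficient
function of an element of `V(φ, y)` to its samples. -/
def interpOp (h : CondA1 φ ∧ CondA2 φ) (hy : IsCIS y) : L2T →L[ℂ] L2T :=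
  ∑' k, ContinuousLinearMap.adjoint (hy.prol k) ∘L genT h k ∘L hy.prol k

lemma interpOp_apply (h : CondA1 φ ∧ CondA2 φ) (hy : IsCIS y) (v : L2T) :
    interpOp h hy v = hy.sample fun k => genT h k (hy.prol k v) := by
  have hs : Summable fun k =>
      ContinuousLinearMap.adjoint (hy.prol k) ∘L genT h k ∘L hy.prol k := by
    refine Summable.of_norm_bounded
      (((summable_norm_genT h).mul_right hy.bound).mul_left hy.bound) fun k => ?_
    refine ContinuousLinearMap.opNorm_le_bound _ (mul_nonneg hy.bound_nonneg
      (mul_nonneg (norm_nonneg _) hy.bound_nonneg)) fun u => ?_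
    refine (hy.norm_adjoint_prol_le k _).trans ?_
    rw [mul_assoc]
    refine mul_le_mul_of_nonneg_left (((genT h k).le_opNorm _).trans ?_) hy.bound_nonneg
    rw [mul_assoc]
    gcongr
    exact (hy.prol k).le_of_opNorm_le (hy.norm_prol_le k) u
  have h1 := (ContinuousLinearMap.apply ℂ L2T v).hasSum hs.hasSum
  exact h1.unique (hy.hasSum_sample (summable_gen h hy v))

/-- Positivity of the Fourier transform makes the interpolation operator coercive: every summand is
positive and the one with `k = 0` is bounded below by the identity. -/
lemma coercive_interpOp (h : CondA1 φ ∧ CondA2 φ) (hy : IsCIS y) (v : L2T) :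
    ‖v‖ ^ 2 ≤ (inner ℂ v (interpOp h hy v)).re := by
  have h1 := Complex.reCLM.hasSum
    ((innerSL ℂ v).hasSum (hy.hasSum_sample (summable_gen h hy v)))
  have h2 : ∀ k, Complex.reCLM ((innerSL ℂ v) (ContinuousLinearMap.adjoint (hy.prol k)
      (genT h k (hy.prol k v)))) = (inner ℂ (hy.prol k v) (genT h k (hy.prol k v))).re :=
    fun k => by
      rw [innerSL_apply_apply, ContinuousLinearMap.adjoint_inner_right, Complex.reCLM_apply]
  have h3 : HasSum (fun k => (inner ℂ (hy.prol k v) (genT h k (hy.prol k v))).re)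
      (inner ℂ v (interpOp h hy v)).re := by
    rw [interpOp_apply]
    exact h1.congr_fun fun k => (h2 k).symm
  refine le_trans ?_ (le_hasSum h3 0 fun k _ => re_inner_genT_nonneg h k _)
  rw [hy.prol_zero, ContinuousLinearMap.id_apply]
  exact le_re_inner_genT_zero h v

/-- Every element of `L₂(𝕋)` arises by sampling the blocks of an element of `V(φ, y)`. -/
lemma exists_mem_space_sample_eq (h : CondA1 φ ∧ CondA2 φ) (hy : IsCIS y) (d : L2T) :
    ∃ g ∈ space φ y, hy.sample (fun k => block k g) = d := by
  obtain ⟨v, hv⟩ := surjective_of_coercive (coercive_interpOp h hy) d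
  refine ⟨gen h hy v, gen_mem_space h hy v, ?_⟩
  rw [← hv, interpOp_apply]
  simp_rw [block_gen]

lemma isContVersion_iff {f : L2R} (hf : Summable fun k => ‖block k f‖) {F : ℝ → ℂ} :
    IsContVersion f F ↔ F = ofBlocks fun k => block k f :=
  ⟨fun hF => hF.unique (isContVersion_ofBlocks hf), fun hF => hF ▸ isContVersion_ofBlocks hf⟩

/-- An element of `V(φ, y)` is determined by the samples of its blocks. -/
lemma eq_of_sample_eq (h : CondA1 φ ∧ CondA2 φ) (hy : IsCIS y) {g g' : L2R}
    (hg : g ∈ space φ y) (hg' : g' ∈ space φ y)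
    (he : hy.sample (fun k => block k g) = hy.sample fun k => block k g') : g = g' := by
  have hsub := Submodule.sub_mem _ hg hg'
  set v : L2T := genM h (block 0 (g - g')) with hv
  have h1 : interpOp h hy v = 0 := by
    rw [interpOp_apply]
    simp_rw [hv, ← block_eq_of_mem_space h hy hsub, map_sub]
    rw [hy.sample_sub (summable_block_of_mem_space h hy hg)
      (summable_block_of_mem_space h hy hg'), he, sub_self]
  have h2 : v = 0 := by
    have h3 := norm_le_of_coercive (coercive_interpOp h hy) v
    rw [h1, norm_zero] at h3
    exact norm_le_zero_iff.1 h3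
  refine sub_eq_zero.1 (eq_zero_of_block_eq_zero fun k => ?_)
  rw [block_eq_of_mem_space h hy hsub, ← hv, h2, map_zero, map_zero]

lemma tsum_eq_zero_add_tsum_ne (a : ℤ → ℝ≥0∞) :
    ∑' k, a k = a 0 + ∑' k : {k : ℤ // k ≠ 0}, a k := by
  have h1 := Summable.tsum_add_tsum_compl (f := a) (s := {0}) ENNReal.summable ENNReal.summable
  rw [tsum_singleton] at h1
  exact h1.symm

/-- The interpolation error is controlled by the defects `r k` of the off-diagonal blocks.  If the
blocks of `f` and of `g ∈ V(φ, y)` have the same samples, the differences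
`q k = T_{φ,k} A_y^k v - r k` of the blocks satisfy `∑ (A_y^k)^* (q k) = 0`.  Coercivity bounds `v`,
and `q 0` is recovered from the other `q k`. -/
lemma tsum_enorm_sub_le (h : CondA1 φ ∧ CondA2 φ) (hy : IsCIS y) {f g : L2R}
    (hf : Summable fun k => ‖block k f‖) (hg : g ∈ space φ y)
    (he : hy.sample (fun k => block k g) = hy.sample fun k => block k f) :
    ∑' k, ‖block k f - block k g‖ₑ ≤
      (ENNReal.ofReal hy.bound + 1) *
        (genConst φ * ENNReal.ofReal hy.bound * ENNReal.ofReal hy.bound + 1) *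
        ∑' k : {k : ℤ // k ≠ 0},
          ‖block k f - genT h k (hy.prol k (genM h (block 0 f)))‖ₑ := by
  set B : ℝ≥0∞ := ENNReal.ofReal hy.bound with hB
  set u : L2T := block 0 f with hu
  set r : ℤ → L2T := fun k => block k f - genT h k (hy.prol k (genM h u)) with hr
  set v : L2T := genM h (block 0 (g - f)) with hv
  set q : ℤ → L2T := fun k => block k g - block k f with hq
  set ρ : ℝ≥0∞ := ∑' k : {k : ℤ // k ≠ 0}, ‖r k‖ₑ with hρ
  have hgs := summable_block_of_mem_space h hy hg
  have hgen := summable_gen h hy (genM h u)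
  have hrs : Summable fun k => ‖r k‖ :=
    Summable.of_nonneg_of_le (fun _ => norm_nonneg _) (fun k => norm_sub_le _ _) (hf.add hgen)
  have hqs : Summable fun k => ‖q k‖ :=
    Summable.of_nonneg_of_le (fun _ => norm_nonneg _) (fun k => norm_sub_le _ _) (hgs.add hf)
  have hq' : ∀ k, q k = genT h k (hy.prol k v) - r k := fun k => by
    simp only [hq, hr, hv, map_sub]
    rw [← block_eq_of_mem_space h hy hg]
    abel
  have hr0 : r 0 = 0 := by
    simp only [hr]
    rw [hy.prol_zero, ContinuousLinearMap.id_apply, genT_genM, sub_self]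
  have hadj : ∀ (k : ℤ) (w : L2T), ‖ContinuousLinearMap.adjoint (hy.prol k) w‖ₑ ≤ B * ‖w‖ₑ :=
    fun k w => by
      have := ENNReal.ofReal_le_ofReal (hy.norm_adjoint_prol_le k w)
      rwa [ENNReal.ofReal_mul hy.bound_nonneg, ofReal_norm, ofReal_norm] at this
  have hprol : ∀ (k : ℤ) (w : L2T), ‖hy.prol k w‖ₑ ≤ B * ‖w‖ₑ := fun k w => by
    have := ENNReal.ofReal_le_ofReal ((hy.prol k).le_of_opNorm_le (hy.norm_prol_le k) w)
    rwa [ENNReal.ofReal_mul hy.bound_nonneg, ofReal_norm, ofReal_norm] at this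
  have hZq : hy.sample q = 0 := by
    rw [hq, hy.sample_sub hgs hf, he, sub_self]
  have hZ : interpOp h hy v = hy.sample r := by
    have h1 := hy.sample_sub (summable_gen h hy v) hrs
    simp_rw [← hq'] at h1
    rw [hZq, ← interpOp_apply] at h1
    exact (sub_eq_zero.1 h1.symm)
  -- coercivity bounds `v` by the samples of `r`, to which the zeroth block does not contribute
  have hvρ : ‖v‖ₑ ≤ B * ρ := by
    have h1 : ‖v‖ₑ ≤ ‖hy.sample r‖ₑ := by
      rw [← hZ, ← ofReal_norm, ← ofReal_norm]
      exact ENNReal.ofReal_le_ofReal (norm_le_of_coercive (coercive_interpOp h hy) v)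
    refine h1.trans ((enorm_tsum_le_tsum_enorm).trans ?_)
    refine (ENNReal.tsum_le_tsum fun k => hadj k (r k)).trans_eq ?_
    rw [ENNReal.tsum_mul_left, tsum_eq_zero_add_tsum_ne, hr0, enorm_zero, zero_add]
  have hoff : ∑' k : {k : ℤ // k ≠ 0}, ‖q k‖ₑ ≤ (genConst φ * B * B + 1) * ρ := by
    have h1 : ∀ k : {k : ℤ // k ≠ 0},
        ‖q k‖ₑ ≤ blockNorm φ k / delta φ * (B * (B * ρ)) + ‖r k‖ₑ := fun k => by
      rw [hq']
      refine (enorm_sub_le).trans ?_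
      gcongr
      refine (enorm_genT_le h k _).trans ?_
      gcongr
      exact (hprol k v).trans (by gcongr)
    refine (ENNReal.tsum_le_tsum h1).trans_eq ?_
    rw [ENNReal.tsum_add, ENNReal.tsum_mul_right, genConst]
    simp_rw [div_eq_mul_inv]
    rw [ENNReal.tsum_mul_right, ← hρ]
    ring
  -- the sampling condition expresses `q 0` through the other `q k`
  have hdiag : ‖q 0‖ₑ ≤ B * ∑' k : {k : ℤ // k ≠ 0}, ‖q k‖ₑ := by
    have h1 := (hy.hasSum_sample hqs)
    rw [hZq] at h1
    have h2 : ‖q 0‖ₑ = ‖∑' k : {k : ℤ // k ≠ 0},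
        ContinuousLinearMap.adjoint (hy.prol k) (q k)‖ₑ := by
      have h3 := h1.summable.tsum_subtype_add_tsum_subtype_compl {0}
      rw [tsum_singleton (0 : ℤ) (fun k => ContinuousLinearMap.adjoint (hy.prol k) (q k)),
        h1.tsum_eq, hy.prol_zero, ContinuousLinearMap.adjoint_id,
        ContinuousLinearMap.id_apply] at h3
      rw [eq_neg_of_add_eq_zero_left h3, enorm_neg]
      rfl
    rw [h2]
    refine (enorm_tsum_le_tsum_enorm).trans ?_
    rw [← ENNReal.tsum_mul_left]
    exact ENNReal.tsum_le_tsum fun k => hadj k (q k)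
  have hrev : ∀ k, ‖block k f - block k g‖ₑ = ‖q k‖ₑ := fun k => enorm_sub_rev _ _
  simp_rw [hrev]
  rw [tsum_eq_zero_add_tsum_ne]
  calc _ ≤ B * ∑' k : {k : ℤ // k ≠ 0}, ‖q k‖ₑ + ∑' k : {k : ℤ // k ≠ 0}, ‖q k‖ₑ := by gcongr
    _ = (B + 1) * ∑' k : {k : ℤ // k ≠ 0}, ‖q k‖ₑ := by ring
    _ ≤ _ := by
      rw [mul_assoc]
      gcongr

end Interpolation

end QSI

theorem mainTheorem2 {A : Type*} (l : Filter A)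
    (x y : ℤ → ℝ) (hx : QSI.IsCIS x) (hy : QSI.IsCIS y)
    (ψ : ℝ → ℂ) (hψ1 : QSI.CondA1 ψ) (hψ2 : QSI.CondA2 ψ)
    (φ : A → ℝ → ℂ)
    (hB1 : ∀ α, QSI.CondA1 (φ α) ∧ QSI.CondA2 (φ α))
    (hB2 : (⨆ α, QSI.genConst (φ α)) < ∞)
    (hB3 : QSI.CondB3 l ψ x φ)
    (hB4 : QSI.CondB4 l ψ x y φ) :
    ∀ f ∈ QSI.space ψ x, ∃ F : ℝ → ℂ, QSI.IsContVersion f F ∧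
      ∃ G : A → ℝ → ℂ,
        (∀ α, QSI.IsInterpolant (φ α) y F (G α) ∧
          ∀ G' : ℝ → ℂ, QSI.IsInterpolant (φ α) y F G' → G' = G α) ∧
        TendstoUniformly G F l := by
  open QSI in
  intro f hf
  have hψ : CondA1 ψ ∧ CondA2 ψ := ⟨hψ1, hψ2⟩
  have hfs := summable_block_of_mem_space hψ hx hf
  choose g hg hge using fun α =>
    exists_mem_space_sample_eq (hB1 α) hy (hy.sample fun k => block k f)
  have hgs := fun α => summable_block_of_mem_space (hB1 α) hy (hg α)
  refine ⟨ofBlocks fun k => block k f, isContVersion_ofBlocks hfs,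
    fun α => ofBlocks fun k => block k (g α), fun α => ⟨⟨⟨g α, hg α,
      isContVersion_ofBlocks (hgs α)⟩, (hy.forall_ofBlocks_eq_iff (hgs α) hfs).2 (hge α)⟩, ?_⟩, ?_⟩
  · rintro G' ⟨⟨g', hg', hG'⟩, hint⟩
    have hgs' := summable_block_of_mem_space (hB1 α) hy hg'
    rw [isContVersion_iff hgs'] at hG'
    rw [hG'] at hint ⊢
    have h1 := (hy.forall_ofBlocks_eq_iff hgs' hfs).1 hint
    rw [eq_of_sample_eq (hB1 α) hy hg' (hg α) (h1.trans (hge α).symm)]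
  · set B : ℝ≥0∞ := ENNReal.ofReal hy.bound
    set u : L2T := block 0 f
    set C : ℝ≥0∞ := (B + 1) * ((⨆ α, genConst (φ α)) * B * B + 1) with hC
    have hCtop : C ≠ ∞ := by
      have h1 : B ≠ ∞ := ENNReal.ofReal_ne_top
      exact ENNReal.mul_ne_top (ENNReal.add_ne_top.2 ⟨h1, ENNReal.one_ne_top⟩)
        (ENNReal.add_ne_top.2 ⟨ENNReal.mul_ne_top (ENNReal.mul_ne_top hB2.ne h1) h1,
          ENNReal.one_ne_top⟩)
    set s₃ : A → ℝ≥0∞ := fun α => ∑' k : {k : ℤ // k ≠ 0},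
      ‖opT ψ k (prolong x k (opM ψ u - opM (φ α) u))‖ₑ
    set s₄ : A → ℝ≥0∞ := fun α => ∑' k : {k : ℤ // k ≠ 0},
      ‖opT (φ α) k (prolong y k (opM (φ α) u)) - opT ψ k (prolong x k (opM (φ α) u))‖ₑ
    have hdefect : ∀ α, ∑' k : {k : ℤ // k ≠ 0},
        ‖block k f - genT (hB1 α) k (hy.prol k (genM (hB1 α) u))‖ₑ ≤ s₃ α + s₄ α := by
      intro α
      rw [← ENNReal.tsum_add]
      refine ENNReal.tsum_le_tsum fun k => ?_
      have e : block k f - genT (hB1 α) k (hy.prol k (genM (hB1 α) u))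
          = opT ψ k (prolong x k (opM ψ u - opM (φ α) u))
            - (opT (φ α) k (prolong y k (opM (φ α) u))
              - opT ψ k (prolong x k (opM (φ α) u))) := by
        rw [block_eq_of_mem_space hψ hx hf]
        simp only [hx.prolong_eq, hy.prolong_eq, opT_eq hψ, opM_eq hψ, opT_eq (hB1 α),
          opM_eq (hB1 α), map_sub]
        abel
      rw [e]
      exact enorm_sub_le
    have hbound : ∀ α t, ‖ofBlocks (fun k => block k f) t - ofBlocks (fun k => block k (g α)) t‖ₑ
        ≤ C * (s₃ α + s₄ α) := by
      intro α t
      rw [← ofBlocks_sub hfs (hgs α)]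
      refine (enorm_ofBlocks_le _ t).trans ((tsum_enorm_sub_le (hB1 α) hy hfs (hg α)
        (hge α)).trans ?_)
      rw [hC]
      gcongr
      · exact le_iSup (fun α => genConst (φ α)) α
      · exact hdefect α
    have hlim : Tendsto (fun α => C * (s₃ α + s₄ α)) l (𝓝 0) := by
      have h1 := (hB3 u).add (hB4 u)
      rw [add_zero] at h1
      simpa using ENNReal.Tendsto.const_mul h1 (Or.inr hCtop)
    rw [EMetric.tendstoUniformly_iff]
    intro ε hε
    filter_upwards [(tendsto_order.1 hlim).2 ε hε] with α hα t
    rw [edist_eq_enorm_sub]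
    exact (hbound α t).trans_lt hα

end
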